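/- **Notation.** Let $\mathbb H$ be the real quaternions, $A^*$ the conjugate transpose, and $\operatorname{rk}$ the rank of a quaternion matrix (the dimension of its left row space). For square $B$, $\operatorname{Ind}B$ is the smallest positive integer $k$ with $\operatorname{rk}(B^{k+1})=\operatorname{rk}(B^k)$. For an $n\times n$ quaternion matrix $B=(b_{ij})$ and an index $i$, the row determinant is $$\operatorname{rdet}_i B=\sum_{\sigma\in S_n}(-1)^{n-\rho}\,\prod_{t=1}^{\rho}\bigl(b_{x_t\,\sigma(x_t)}\,b_{\sigma(x_t)\,\sigma^2(x_t)}\cdots b_{\sigma^{l_t-1}(x_t)\,x_t}\bigr)\quad\text{(factors ordered from left to right)},$$ where $\rho$ is the number of cycles of $\sigma$ (fixed points included), $x_1=i$, and $x_2<\dots<x_\rho$ are the least elements of the cycles not containing $i$, the cycle of $x_t$ having length $l_t$. The column determinant $\operatorname{cdet}_j B$ is defined in the same way with $x_1=j$, with the cycle factors $\bigl(b_{x_t\,\sigma^{l_t-1}(x_t)}\cdots b_{\sigma^2(x_t)\,\sigma(x_t)}\,b_{\sigma(x_t)\,x_t}\bigr)$ multiplied from right to left for $t=1,\dots,\rho$.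 For Hermitian $B$ all row and column determinants coincide and are real; their common value is $\det B$, with $\det=1$ for the empty matrix. $B_{i.}(b)$ and $B_{.j}(c)$ are $B$ with its $i$-th row replaced by the row $b$, respectively its $j$-th column replaced by the column $c$; $B_\alpha^\alpha$ is the principal submatrix on the index set $\alpha$, and $|B|_\alpha^\alpha=\det B_\alpha^\alpha$ for Hermitian $B$. $I_{r,m}=J_{r,m}$ is the set of $r$-element subsets of $\{1,\dots,m\}$, and $I_{r,m}\{j\}=J_{r,m}\{j\}$ the set of those that contain $j$. In the sums below, a row or column position inside a principal submatrix is named by its original index. For a matrix denoted by a capital letter, the lower-case letter with subscript $i.$ or $.j$ is its $i$-th row or $j$-th column. **Generalized inverses.** Let $A\in\mathbb H^{m\times n}$ and $W\in\mathbb H^{n\times m}$. The Moore–Penrose inverse $A^\dagger$ is the unique $X$ with $AXA=A$, $XAX=X$, $(AX)^*=AX$, $(XA)^*=XA$. The $W$-weighted Drazin inverse $A^{d,W}$ is the unique $X$ with $(AW)^{l+1}XW=(AW)^{l}$, $XWAWX=X$, $AWX=XWA$, where $l=\operatorname{Ind}(AW)$. The weighted CMP inverse is $$A^{c,\dagger,W}=A^\dagger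 A\,W A^{d,W}W\,A A^\dagger=(a^{c,\dagger,W}_{ij})\in\mathbb H^{n\times m}.$$ **Theorem.** Let $A\in\mathbb H^{m\times n}$ have rank $r$, let $W\in\mathbb H^{n\times m}$ be nonzero, and let $k=\max\{\operatorname{Ind}(WA),\operatorname{Ind}(AW)\}$. Then $A^\dagger$ and $A^{d,W}$ exist and are unique, and the following hold. (i) If $WA$ is Hermitian and $\operatorname{rk}(WA)^k=r_1$, then for all $i\in\{1,\dots,n\}$, $j\in\{1,\dots,m\}$, $$a^{c,\dagger,W}_{ij}=\frac{\sum_{\alpha\in I_{r,m}\{j\}}\operatorname{rdet}_j\bigl((AA^*)_{j.}(\widetilde\omega_{i.})\bigr)_\alpha^\alpha}{\Bigl(\sum_{\beta\in J_{r,n}}|A^*A|_\beta^\beta\Bigr)^2\sum_{\alpha\in I_{r_1,n}}\bigl|(WA)^{k+2}\bigr|_\alpha^\alpha},$$ where $\widetilde\Omega=\Omega WAA^*$; $\Omega=(\omega_{is})\in\mathbb H^{n\times n}$ has the entries $\omega_{is}=\sum_{\alpha\in I_{r_1,n}\{s\}}\operatorname{rdet}_s\bigl((WA)^{k+2}_{s.}(\phi^{(1)}_{i.})\bigr)_\alpha^\alpha$;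 $\phi^{(1)}_{i.}$ is the $i$-th row of $\Phi_1=\Phi A(WA)^k$; $\Phi=(\phi_{it})\in\mathbb H^{n\times m}$ has the entries $\phi_{it}=\sum_{\beta\in J_{r,n}\{i\}}\operatorname{cdet}_i\bigl((A^*A)_{.i}(w^{(1)}_{.t})\bigr)_\beta^\beta$; and $w^{(1)}_{.t}$ is the $t$-th column of $W_1=A^*AW$. (ii) If $AW$ is Hermitian and $\operatorname{rk}(AW)^k=r_1$, then for all $i\in\{1,\dots,n\}$, $j\in\{1,\dots,m\}$, $$a^{c,\dagger,W}_{ij}=\frac{\sum_{\beta\in J_{r,n}\{i\}}\operatorname{cdet}_i\bigl((A^*A)_{.i}(\widetilde\upsilon_{.j})\bigr)_\beta^\beta}{\Bigl(\sum_{\alpha\in I_{r,m}}|AA^*|_\alpha^\alpha\Bigr)^2\sum_{\beta\in J_{r_1,m}}\bigl|(AW)^{k+2}\bigr|_\beta^\beta},$$ where $\widetilde\Upsilon=A^*AW\Upsilon$; $\Upsilon=(\upsilon_{tj})\in\mathbb H^{m\times m}$ has the entries $\upsilon_{tj}=\sum_{\beta\in J_{r_1,m}\{t\}}\operatorname{cdet}_t\bigl((AW)^{k+2}_{.t}(\psi^{(1)}_{.j})\bigr)_\beta^\beta$;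 $\psi^{(1)}_{.j}$ is the $j$-th column of $\Psi^{(1)}=(AW)^kA\Psi$; $\Psi=(\psi_{sj})\in\mathbb H^{n\times m}$ has the entries $\psi_{sj}=\sum_{\alpha\in I_{r,m}\{j\}}\operatorname{rdet}_j\bigl((AA^*)_{j.}(w^{(2)}_{s.})\bigr)_\alpha^\alpha$; and $w^{(2)}_{s.}$ is the $s$-th row of $W_2=WAA^*$. In both cases each sum of principal minors in the denominator is nonzero. -/

import Mathlib

namespace QuatMat

section RowColumnDeterminants

variable {ι R : Type*} [Fintype ι] [LinearOrder ι] [Ring R]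

/-- The first elements of the cycles of `σ` (fixed points are cycles of length one), listed in the
order in which the row and column determinants along `i` use them: first `i`, then, in increasing
order, the minimal elements of the cycles that do not contain `i`. -/
def leaders (σ : Equiv.Perm ι) (i : ι) : List ι :=
  i :: (Finset.univ.filter fun x : ι =>
    ¬ σ.SameCycle i x ∧ ∀ y : ι, σ.SameCycle x y → x ≤ y).sort

/-- The product `a_{x,σx} a_{σx,σ²x} ⋯ a_{σ^{l-1}x,x}` along the cycle of `x`, of length `l`. -/
noncomputable def rowCycle (A : Matrix ι ι R) (σ : Equiv.Perm ι) (x : ι) : R :=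
  ((List.range (Function.minimalPeriod σ x)).map fun t =>
    A ((σ ^ t) x) ((σ ^ (t + 1)) x)).prod

/-- The product `a_{x,σ^{l-1}x} ⋯ a_{σ²x,σx} a_{σx,x}` along the cycle of `x`, of length `l`. -/
noncomputable def colCycle (A : Matrix ι ι R) (σ : Equiv.Perm ι) (x : ι) : R :=
  ((List.range (Function.minimalPeriod σ x)).reverse.map fun t =>
    A ((σ ^ (t + 1)) x) ((σ ^ t) x)).prod

/-- The row determinant of `A` along the row `i`: the cycle factors of `σ` are multiplied from left
to right, beginning with the cycle of `i`; the sign is `(-1)^(n - r)` with `r` the number of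
cycles. -/
noncomputable def rdet (A : Matrix ι ι R) (i : ι) : R :=
  ∑ σ : Equiv.Perm ι, (-1) ^ (Fintype.card ι - (leaders σ i).length) *
    ((leaders σ i).map (rowCycle A σ)).prod

/-- The column determinant of `A` along the column `j`: the cycle factors of `σ` are multiplied
from right to left, beginning with the cycle of `j`. -/
noncomputable def cdet (A : Matrix ι ι R) (j : ι) : R :=
  ∑ σ : Equiv.Perm ι, (-1) ^ (Fintype.card ι - (leaders σ j).length) *
    ((leaders σ j).reverse.map (colCycle A σ)).prod

open Classical in
/-- The determinant of a Hermitian quaternion matrix. All its row and column determinants coincide;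
the row determinant along the first row is used here. The empty matrix has determinant `1`. -/
noncomputable def hdet (A : Matrix ι ι R) : R :=
  if h : Nonempty ι then rdet A (Finset.univ.min' (Finset.univ_nonempty_iff.mpr h)) else 1

end RowColumnDeterminants

section PrincipalMinors

variable {m n : ℕ} {R : Type*} [Ring R]

/-- The principal submatrix with rows and columns indexed by `α`. -/
def principal (A : Matrix (Fin n) (Fin n) R) (α : Finset (Fin n)) : Matrix α α R :=
  A.submatrix Subtype.val Subtype.val

/-- The sum of the principal minors of size `r` of a Hermitian matrix `H`. -/
noncomputable def minorSum (H : Matrix (Fin n) (Fin n) R) (r : ℕ) : R :=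
  ∑ α : {α : Finset (Fin n) // α.card = r}, hdet (principal H α.1)

/-- The matrix whose `(i, j)` entry is `∑_β cdet_i ((H_{.i}(c_{.j}))_β^β)`, the sum being over the
`β` of size `r` that contain `i`: the `i`-th column of `H` is replaced by the `j`-th column of
`C`. -/
noncomputable def cdetSums (H : Matrix (Fin n) (Fin n) R) (r : ℕ) (C : Matrix (Fin n) (Fin m) R) :
    Matrix (Fin n) (Fin m) R :=
  Matrix.of fun i j => ∑ β : {β : Finset (Fin n) // β.card = r ∧ i ∈ β},
    cdet (principal (H.updateCol i fun l => C l j) β.1) ⟨i, β.2.2⟩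

/-- The matrix whose `(i, j)` entry is `∑_α rdet_j ((H_{j.}(b_{i.}))_α^α)`, the sum being over the
`α` of size `r` that contain `j`: the `j`-th row of `H` is replaced by the `i`-th row of `B`. -/
noncomputable def rdetSums (H : Matrix (Fin n) (Fin n) R) (r : ℕ) (B : Matrix (Fin m) (Fin n) R) :
    Matrix (Fin m) (Fin n) R :=
  Matrix.of fun i j => ∑ α : {α : Finset (Fin n) // α.card = r ∧ j ∈ α},
    rdet (principal (H.updateRow j fun l => B i l) α.1) ⟨j, α.2.2⟩

end PrincipalMinors

section GeneralizedInverses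

variable {m n : ℕ}

/-- The rank of a quaternion matrix: the dimension of its left row space. -/
noncomputable def rk (A : Matrix (Fin m) (Fin n) (Quaternion ℝ)) : ℕ :=
  Module.finrank (Quaternion ℝ) (Submodule.span (Quaternion ℝ) (Set.range fun i => A i))

/-- The index of a square matrix: the smallest positive `k` with `rk (A^(k+1)) = rk (A^k)`. -/
noncomputable def ind (A : Matrix (Fin n) (Fin n) (Quaternion ℝ)) : ℕ :=
  sInf {k : ℕ | 0 < k ∧ rk (A ^ (k + 1)) = rk (A ^ k)}

/-- `X` satisfies the four Penrose equations for `A`. -/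
def IsMoorePenrose (A : Matrix (Fin m) (Fin n) (Quaternion ℝ))
    (X : Matrix (Fin n) (Fin m) (Quaternion ℝ)) : Prop :=
  A * X * A = A ∧ X * A * X = X ∧ (A * X).conjTranspose = A * X ∧ (X * A).conjTranspose = X * A

/-- `X` satisfies the equations of the `W`-weighted Drazin inverse of `A`. -/
def IsWeightedDrazin (A : Matrix (Fin m) (Fin n) (Quaternion ℝ))
    (W : Matrix (Fin n) (Fin m) (Quaternion ℝ))
    (X : Matrix (Fin m) (Fin n) (Quaternion ℝ)) : Prop :=
  (A * W) ^ (ind (A * W) + 1) * X * W = (A * W) ^ ind (A * W) ∧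
    X * W * A * W * X = X ∧ A * W * X = X * W * A

open Classical in
/-- The Moore-Penrose inverse. -/
noncomputable def mpInv (A : Matrix (Fin m) (Fin n) (Quaternion ℝ)) :
    Matrix (Fin n) (Fin m) (Quaternion ℝ) :=
  if h : ∃ X, IsMoorePenrose A X then h.choose else 0

open Classical in
/-- The `W`-weighted Drazin inverse. -/
noncomputable def wDrazin (A : Matrix (Fin m) (Fin n) (Quaternion ℝ))
    (W : Matrix (Fin n) (Fin m) (Quaternion ℝ)) : Matrix (Fin m) (Fin n) (Quaternion ℝ) :=
  if h : ∃ X, IsWeightedDrazin A W X then h.choose else 0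

/-- The weighted CMP inverse. -/
noncomputable def wcmp (A : Matrix (Fin m) (Fin n) (Quaternion ℝ))
    (W : Matrix (Fin n) (Fin m) (Quaternion ℝ)) : Matrix (Fin n) (Fin m) (Quaternion ℝ) :=
  mpInv A * A * W * wDrazin A W * W * A * mpInv A

end GeneralizedInverses

end QuatMat

open QuatMat
open scoped Matrix

/-
For a Hermitian quaternion matrix `H`, let `cofSum H s` be the sum of the cofactor matrices of its
principal submatrices of size `s`. The sums of row and column determinants in the theorem are then
products by `cofSum H s` on the right and on the left. The key identity is the Faddeev-LeVerrier
recursion `cofSum H (s + 1) = minorSum H s • 1 - H * cofSum H s`; it holds because, by induction on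
the size, the row determinants of a Hermitian matrix are real and equal and its cofactors form a
Hermitian matrix. Together with the trace of `H * cofSum H s` it shows that the last nonzero sum of
principal minors is the one of size `rk H`, and that `H * cofSum H (rk H)` is that sum times the
projection onto the column space of `H`. For `Aᴴ * A`, `A * Aᴴ` and the powers of a Hermitian
`W * A` the projections are `A⁺A`, `AA⁺` and `WA(WA)ᵈ`, and the weighted CMP inverse is
`A⁺A · WA(WA)ᵈ · A⁺`; for a Hermitian `A * W` it is `A⁺ · AW(AW)ᵈ · AA⁺`.
-/

namespace QuatMat

open scoped Quaternion

section Cycles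

open Equiv Equiv.Perm

variable {ι : Type*}

theorem sameCycle_pow_apply (σ : Perm ι) (x : ι) (t : ℕ) : σ.SameCycle x ((σ ^ t) x) :=
  sameCycle_pow_right.mpr (SameCycle.refl σ x)

theorem sameCycle_iff_exists_nat_pow [Finite ι] {σ : Perm ι} {x y : ι} :
    σ.SameCycle x y ↔ ∃ t : ℕ, (σ ^ t) x = y :=
  ⟨SameCycle.exists_nat_pow_eq, fun ⟨t, ht⟩ => ht ▸ sameCycle_pow_apply σ x t⟩

theorem sameCycle_iff_eq_of_fixed {σ : Perm ι} {j x : ι} (hj : σ j = j) :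
    σ.SameCycle j x ↔ x = j :=
  ⟨fun h => (h.eq_of_left hj).symm, fun h => h ▸ SameCycle.refl σ x⟩

theorem pow_apply_ne_of_fixed {τ : Perm ι} {i x : ι} (hi : τ i = i) (hx : x ≠ i) (t : ℕ) :
    (τ ^ t) x ≠ i := fun h =>
  hx ((τ ^ t).injective (h.trans (pow_apply_eq_self_of_apply_eq_self hi t).symm))

theorem minimalPeriod_pos [Finite ι] (σ : Perm ι) (x : ι) : 0 < Function.minimalPeriod σ x :=
  Function.minimalPeriod_pos_of_mem_periodicPts (σ.injective.mem_periodicPts x)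

theorem pow_minimalPeriod_apply (σ : Perm ι) (x : ι) :
    (σ ^ Function.minimalPeriod σ x) x = x := by
  rw [← iterate_eq_pow, Function.iterate_minimalPeriod]

theorem pow_apply_ne_self_of_lt_minimalPeriod {σ : Perm ι} {x : ι} {t : ℕ} (h0 : t ≠ 0)
    (ht : t < Function.minimalPeriod σ x) : (σ ^ t) x ≠ x := by
  rw [← iterate_eq_pow]
  exact Function.not_isPeriodicPt_of_pos_of_lt_minimalPeriod h0 ht

theorem minimalPeriod_congr_pow {κ : Type*} {σ : Perm ι} {τ : Perm κ} {x : ι} {y : κ}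
    (h : ∀ t : ℕ, (σ ^ t) x = x ↔ (τ ^ t) y = y) :
    Function.minimalPeriod σ x = Function.minimalPeriod τ y := by
  rw [Function.minimalPeriod_eq_minimalPeriod_iff]
  intro t
  simpa only [Function.IsPeriodicPt, Function.IsFixedPt, iterate_eq_pow] using h t

variable [DecidableEq ι]

theorem pow_mul_swap_apply_of_not_sameCycle {τ : Perm ι} {i j x : ι} (hi : τ i = i)
    (hxi : x ≠ i) (hx : ¬ τ.SameCycle j x) (t : ℕ) : ((τ * swap i j) ^ t) x = (τ ^ t) x := by
  induction t with
  | zero => rfl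
  | succ t ih =>
    have hj : (τ ^ t) x ≠ j := fun h => hx (h ▸ sameCycle_pow_apply τ x t).symm
    rw [pow_succ', Perm.mul_apply, ih, Perm.mul_apply,
      swap_apply_of_ne_of_ne (pow_apply_ne_of_fixed hi hxi t) hj, pow_succ', Perm.mul_apply]

-- Right multiplication by `swap i j` inserts the fixed point `i` into its cycle right after `j`.
theorem pow_mul_swap_apply_self {τ : Perm ι} {i j : ι} (hi : τ i = i) (hij : i ≠ j) {t : ℕ}
    (ht : t < Function.minimalPeriod τ j) :
    ((τ * swap i j) ^ (t + 2)) j = (τ ^ (t + 1)) j := by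
  induction t with
  | zero => simp [pow_succ, hi]
  | succ t ih =>
    rw [pow_succ', Perm.mul_apply, ih (by omega), Perm.mul_apply,
      swap_apply_of_ne_of_ne (pow_apply_ne_of_fixed hi hij.symm _)
        (pow_apply_ne_self_of_lt_minimalPeriod (by omega) ht), pow_succ' _ (t + 1), Perm.mul_apply]

theorem minimalPeriod_mul_swap [Finite ι] {τ : Perm ι} {i j : ι} (hi : τ i = i) (hij : i ≠ j) :
    Function.minimalPeriod (τ * swap i j : Perm ι) j = Function.minimalPeriod τ j + 1 := by
  obtain ⟨p, hp⟩ := Nat.exists_eq_succ_of_ne_zero (minimalPeriod_pos τ j).ne'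
  have hperiod : ((τ * swap i j) ^ (p + 2)) j = j := by
    rw [pow_mul_swap_apply_self hi hij (by omega), ← Nat.succ_eq_add_one, ← hp,
      pow_minimalPeriod_apply]
  refine le_antisymm ?_ (not_lt.mp fun hlt => ?_)
  · rw [hp]
    refine Function.IsPeriodicPt.minimalPeriod_le (by omega) ?_
    rwa [Function.IsPeriodicPt, Function.IsFixedPt, iterate_eq_pow]
  · have hq := pow_minimalPeriod_apply (τ * swap i j) j
    have hpos := minimalPeriod_pos (τ * swap i j) j
    rcases h : Function.minimalPeriod (τ * swap i j : Perm ι) j with _ | _ | t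
    · omega
    · rw [h, zero_add, pow_one, Perm.mul_apply, swap_apply_right, hi] at hq
      exact hij hq
    · rw [h, pow_mul_swap_apply_self hi hij (by omega)] at hq
      exact pow_apply_ne_self_of_lt_minimalPeriod (by omega) (by omega) hq

theorem sameCycle_self_mul_swap [Finite ι] {τ : Perm ι} {i j x : ι} (hi : τ i = i) (hij : i ≠ j)
    (hxi : x ≠ i) : (τ * swap i j).SameCycle j x ↔ τ.SameCycle j x := by
  constructor
  · intro h
    by_contra hx
    obtain ⟨t, ht⟩ := h.symm.exists_nat_pow_eq
    rw [pow_mul_swap_apply_of_not_sameCycle hi hxi hx] at ht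
    exact hx (ht ▸ sameCycle_pow_apply τ x t).symm
  · intro h
    obtain ⟨t, ht⟩ := h.exists_nat_pow_eq
    rw [← iterate_eq_pow, ← Function.iterate_mod_minimalPeriod_eq, iterate_eq_pow] at ht
    have hlt := Nat.mod_lt t (minimalPeriod_pos τ j)
    rcases hs : t % Function.minimalPeriod τ j with _ | s
    · rw [← ht, hs]; rfl
    · rw [← ht, hs, ← pow_mul_swap_apply_self hi hij (by omega)]
      exact sameCycle_pow_apply _ _ _

theorem sameCycle_mul_swap_of_not_sameCycle [Finite ι] {τ : Perm ι} {i j x y : ι} (hi : τ i = i)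
    (hxi : x ≠ i) (hx : ¬ τ.SameCycle j x) :
    (τ * swap i j).SameCycle x y ↔ τ.SameCycle x y := by
  simp only [sameCycle_iff_exists_nat_pow, pow_mul_swap_apply_of_not_sameCycle hi hxi hx]

end Cycles

section CycleProducts

open Equiv Equiv.Perm

variable {ι R : Type*} [Ring R]

/-- The summand of a determinant of size `n` belonging to the permutation `σ`, whose cycles have
the leaders `L`. -/
noncomputable def cycleTerm (A : Matrix ι ι R) (n : ℕ) (σ : Perm ι) (L : List ι) : R :=
  (-1) ^ (n - L.length) * (L.map (rowCycle A σ)).prod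

theorem rowCycle_of_fixed (A : Matrix ι ι R) {σ : Perm ι} {j : ι} (hj : σ j = j) :
    rowCycle A σ j = A j j := by
  have hp : Function.minimalPeriod σ j = 1 := Function.minimalPeriod_eq_one_iff_isFixedPt.mpr hj
  simp [rowCycle, hp, hj]

theorem cycleTerm_cons (A : Matrix ι ι R) (n : ℕ) (σ : Perm ι) (x : ι) (L : List ι) :
    cycleTerm A (n + 1) σ (x :: L) = rowCycle A σ x * cycleTerm A n σ L := by
  rw [cycleTerm, List.length_cons, Nat.add_sub_add_right, List.map_cons, List.prod_cons,
    ← mul_assoc, ((Commute.neg_one_left _).pow_left _).eq, mul_assoc, cycleTerm]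

variable [DecidableEq ι]

theorem rowCycle_updateRow_of_not_sameCycle (A : Matrix ι ι R) {τ : Perm ι} {j x : ι}
    (hx : ¬ τ.SameCycle j x) (b : ι → R) :
    rowCycle (A.updateRow j b) τ x = rowCycle A τ x := by
  unfold rowCycle
  congr 1
  refine List.map_congr_left fun t _ => ?_
  rw [Matrix.updateRow_ne fun h => hx (h ▸ sameCycle_pow_apply τ x t).symm]

theorem rowCycle_mul_swap_of_not_sameCycle (A : Matrix ι ι R) {τ : Perm ι} {i j x : ι}
    (hi : τ i = i) (hxi : x ≠ i) (hx : ¬ τ.SameCycle j x) :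
    rowCycle A (τ * swap i j) x = rowCycle A τ x := by
  have hpow := pow_mul_swap_apply_of_not_sameCycle hi hxi hx
  have hp : Function.minimalPeriod (τ * swap i j : Perm ι) x = Function.minimalPeriod τ x :=
    minimalPeriod_congr_pow fun t => by rw [hpow]
  simp only [rowCycle, hp, hpow]

theorem rowCycle_mul_swap_self [Finite ι] (A : Matrix ι ι R) {τ : Perm ι} {i j : ι}
    (hi : τ i = i) (hij : i ≠ j) : rowCycle A (τ * swap i j) j =
      A j i * rowCycle (A.updateRow j (A i)) τ j := by
  unfold rowCycle
  rw [minimalPeriod_mul_swap hi hij, List.range_succ_eq_map, List.map_cons, List.prod_cons,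
    List.map_map]
  congr 1
  · simp [hi]
  congr 1
  refine List.map_congr_left fun t ht => ?_
  rw [List.mem_range] at ht
  simp only [Function.comp_apply, Nat.succ_eq_add_one]
  rw [pow_mul_swap_apply_self hi hij ht]
  rcases t with _ | t
  · simp [hi]
  · rw [pow_mul_swap_apply_self hi hij (by omega),
      Matrix.updateRow_ne (pow_apply_ne_self_of_lt_minimalPeriod t.succ_ne_zero ht)]

theorem cycleTerm_mul_swap [Finite ι] (A : Matrix ι ι R) {n : ℕ} {τ : Perm ι} {i j : ι}
    (hi : τ i = i) (hij : i ≠ j) {L : List ι} (hn : L.length < n)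
    (hL : ∀ x ∈ L, x ≠ i ∧ ¬ τ.SameCycle j x) :
    cycleTerm A (n + 1) (τ * swap i j) (j :: L) =
      A j i * -cycleTerm (A.updateRow j (A i)) n τ (j :: L) := by
  obtain ⟨n, rfl⟩ := Nat.exists_eq_succ_of_ne_zero (Nat.ne_zero_of_lt hn)
  have hmap : L.map (rowCycle A (τ * swap i j)) = L.map (rowCycle (A.updateRow j (A i)) τ) := by
    refine List.map_congr_left fun x hx => ?_
    rw [rowCycle_mul_swap_of_not_sameCycle A hi (hL x hx).1 (hL x hx).2,
      rowCycle_updateRow_of_not_sameCycle A (hL x hx).2]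
  rw [cycleTerm_cons, cycleTerm_cons, rowCycle_mul_swap_self A hi hij, cycleTerm, hmap,
    Nat.succ_sub (Nat.lt_succ_iff.mp hn), pow_succ, mul_neg_one, neg_mul, mul_neg, mul_neg,
    mul_assoc, cycleTerm]

end CycleProducts

section RelativeDeterminants

open Equiv Equiv.Perm

variable {ι R : Type*} [Fintype ι] [LinearOrder ι]

/-- The permutations that move only elements of `α`. -/
def permsOn (α : Finset ι) : Finset (Perm ι) :=
  Finset.univ.filter fun σ => ∀ x, x ∉ α → σ x = x

/-- The minimal elements of the cycles of `σ` in `α`, in increasing order. -/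
def cycleMins (α : Finset ι) (σ : Perm ι) : List ι :=
  (α.filter fun x => ∀ y : ι, σ.SameCycle x y → x ≤ y).sort

/-- The minimal elements of the cycles of `σ` in `α` other than the cycle of `i`, in increasing
order. -/
def otherLeaders (α : Finset ι) (σ : Perm ι) (i : ι) : List ι :=
  (α.filter fun x => ¬ σ.SameCycle i x ∧ ∀ y : ι, σ.SameCycle x y → x ≤ y).sort

theorem mem_permsOn {α : Finset ι} {σ : Perm ι} : σ ∈ permsOn α ↔ ∀ x, x ∉ α → σ x = x := by
  simp [permsOn]

theorem mem_iff_of_sameCycle {α : Finset ι} {σ : Perm ι} (hσ : σ ∈ permsOn α) {x y : ι}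
    (h : σ.SameCycle x y) : x ∈ α ↔ y ∈ α := by
  suffices hcl : ∀ {x y}, σ.SameCycle x y → x ∈ α → y ∈ α from ⟨hcl h, hcl h.symm⟩
  intro x y hxy hx
  by_contra hy
  exact hy ((sameCycle_iff_eq_of_fixed (mem_permsOn.mp hσ y hy)).mp hxy.symm ▸ hx)

theorem permsOn_erase {α : Finset ι} {j : ι} :
    permsOn (α.erase j) = (permsOn α).filter fun σ => σ j = j := by
  ext σ
  simp only [Finset.mem_filter, mem_permsOn, Finset.mem_erase, not_and_or, not_not]
  refine ⟨fun h => ⟨fun x hx => h x (.inr hx), h j (.inl rfl)⟩, ?_⟩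
  rintro ⟨h, hj⟩ x (rfl | hx)
  exacts [hj, h x hx]

theorem mul_swap_mem_permsOn_erase {α : Finset ι} {i j : ι} (hi : i ∈ α) (hj : j ∈ α)
    {σ : Perm ι} : σ * swap i j ∈ permsOn (α.erase i) ↔ σ ∈ permsOn α ∧ σ j = i := by
  simp only [permsOn_erase, Finset.mem_filter, Perm.mul_apply, swap_apply_left, mem_permsOn]
  refine and_congr_left fun _ => forall₂_congr fun x hx => ?_
  rw [swap_apply_of_ne_of_ne (ne_of_mem_of_not_mem hi hx).symm (ne_of_mem_of_not_mem hj hx).symm]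

theorem mem_otherLeaders {α : Finset ι} {σ : Perm ι} {j x : ι} :
    x ∈ otherLeaders α σ j ↔ x ∈ α ∧ ¬ σ.SameCycle j x ∧ ∀ y : ι, σ.SameCycle x y → x ≤ y := by
  simp [otherLeaders]

theorem otherLeaders_of_fixed {α : Finset ι} {σ : Perm ι} {j : ι} (hj : σ j = j) :
    otherLeaders α σ j = cycleMins (α.erase j) σ := by
  unfold otherLeaders cycleMins
  congr 1
  ext x
  simp only [Finset.mem_filter, Finset.mem_erase, sameCycle_iff_eq_of_fixed hj]
  tauto

theorem otherLeaders_mul_swap {α : Finset ι} {τ : Perm ι} {i j : ι} (hi : τ i = i)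
    (hij : i ≠ j) : otherLeaders α (τ * swap i j) j = otherLeaders (α.erase i) τ j := by
  unfold otherLeaders
  congr 1
  ext x
  simp only [Finset.mem_filter, Finset.mem_erase]
  by_cases hxi : x = i
  · have hcycle : (τ * swap i j).SameCycle j i := by
      simpa [hi] using sameCycle_pow_apply (τ * swap i j) j 1
    simp [hxi, hcycle]
  · rw [sameCycle_self_mul_swap hi hij hxi]
    by_cases hx : τ.SameCycle j x
    · simp [hx]
    · simp [hx, hxi, sameCycle_mul_swap_of_not_sameCycle hi hxi hx]

theorem length_otherLeaders_lt {α : Finset ι} {σ : Perm ι} {j : ι} (hj : j ∈ α) :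
    (otherLeaders α σ j).length < α.card := by
  rw [otherLeaders, Finset.length_sort]
  refine Finset.card_lt_card (Finset.filter_ssubset.mpr ⟨j, hj, fun h => ?_⟩)
  exact h.1 (SameCycle.refl σ j)

theorem cycleMins_eq_cons {α : Finset ι} (h : α.Nonempty) {σ : Perm ι} (hσ : σ ∈ permsOn α) :
    cycleMins α σ = α.min' h :: otherLeaders α σ (α.min' h) := by
  unfold cycleMins otherLeaders
  rw [← Finset.sort_insert (r := (· ≤ ·))
    (fun x hx => α.min'_le x (Finset.mem_of_mem_filter x hx)) (by simp [SameCycle.refl])]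
  congr 1
  ext x
  simp only [Finset.mem_filter, Finset.mem_insert]
  constructor
  · rintro ⟨hx, hmin⟩
    by_cases hs : σ.SameCycle (α.min' h) x
    · exact .inl (le_antisymm (hmin _ hs.symm) (α.min'_le x hx))
    · exact .inr ⟨hx, hs, hmin⟩
  · rintro (rfl | ⟨hx, _, hmin⟩)
    · exact ⟨α.min'_mem h, fun y hy =>
        α.min'_le y ((mem_iff_of_sameCycle hσ hy).mp (α.min'_mem h))⟩
    · exact ⟨hx, hmin⟩

variable [Ring R]

/-- The row determinant along `i` of the principal submatrix on `α`, as a sum over permutations of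
the whole index set. -/
noncomputable def rdetOn (A : Matrix ι ι R) (α : Finset ι) (i : ι) : R :=
  ∑ σ ∈ permsOn α, cycleTerm A α.card σ (i :: otherLeaders α σ i)

/-- The determinant of the principal submatrix on `α`, as a sum over permutations of the whole
index set. -/
noncomputable def hdetOn (A : Matrix ι ι R) (α : Finset ι) : R :=
  ∑ σ ∈ permsOn α, cycleTerm A α.card σ (cycleMins α σ)

theorem sum_cycleTerm_of_fixed (A : Matrix ι ι R) {α : Finset ι} {j : ι} (hj : j ∈ α) :
    ∑ σ ∈ (permsOn α).filter (fun σ => σ j = j), cycleTerm A α.card σ (j :: otherLeaders α σ j) =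
      A j j * hdetOn A (α.erase j) := by
  rw [← permsOn_erase, hdetOn, Finset.mul_sum]
  refine Finset.sum_congr rfl fun σ hσ => ?_
  have hσj : σ j = j := mem_permsOn.mp hσ j (Finset.notMem_erase j α)
  rw [← Finset.card_erase_add_one hj, cycleTerm_cons, rowCycle_of_fixed A hσj,
    otherLeaders_of_fixed hσj]

theorem sum_cycleTerm_of_apply_eq (A : Matrix ι ι R) {α : Finset ι} {i j : ι} (hi : i ∈ α)
    (hj : j ∈ α) (hij : i ≠ j) :
    ∑ σ ∈ (permsOn α).filter (fun σ => σ j = i), cycleTerm A α.card σ (j :: otherLeaders α σ j) =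
      A j i * -rdetOn (A.updateRow j (A i)) (α.erase i) j := by
  rw [rdetOn, ← Finset.sum_neg_distrib, Finset.mul_sum]
  refine Finset.sum_equiv (Equiv.mulRight (swap i j))
    (fun σ => by simp [mul_swap_mem_permsOn_erase hi hj]) fun σ hσ => ?_
  obtain ⟨τ, rfl⟩ : ∃ τ, σ = τ * swap i j := ⟨σ * swap i j, by simp [mul_assoc]⟩
  have hτi : τ i = i := by simpa using (Finset.mem_filter.mp hσ).2
  simp only [Equiv.coe_mulRight, mul_assoc τ, swap_mul_self, mul_one]
  rw [otherLeaders_mul_swap hτi hij, ← Finset.card_erase_add_one hi]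
  refine cycleTerm_mul_swap A hτi hij
    (length_otherLeaders_lt (Finset.mem_erase.mpr ⟨hij.symm, hj⟩)) fun x hx => ?_
  rw [mem_otherLeaders] at hx
  exact ⟨Finset.ne_of_mem_erase hx.1, hx.2.1⟩

theorem rdetOn_eq (A : Matrix ι ι R) (α : Finset ι) {j : ι} (hj : j ∈ α) :
    rdetOn A α j = A j j * hdetOn A (α.erase j) +
      ∑ i ∈ α.erase j, A j i * -rdetOn (A.updateRow j (A i)) (α.erase i) j := by
  have hmaps : ∀ σ ∈ permsOn α, σ j ∈ α := fun σ hσ =>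
    (mem_iff_of_sameCycle hσ (by simpa using sameCycle_pow_apply σ j 1)).mp hj
  rw [rdetOn, ← Finset.sum_fiberwise_of_maps_to hmaps, ← Finset.add_sum_erase _ _ hj,
    sum_cycleTerm_of_fixed A hj]
  congr 1
  refine Finset.sum_congr rfl fun i hi => ?_
  exact sum_cycleTerm_of_apply_eq A (Finset.mem_of_mem_erase hi) hj (Finset.ne_of_mem_erase hi)

theorem hdetOn_eq_rdetOn (A : Matrix ι ι R) {α : Finset ι} (h : α.Nonempty) :
    hdetOn A α = rdetOn A α (α.min' h) :=
  Finset.sum_congr rfl fun σ hσ => by rw [cycleMins_eq_cons h hσ]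

theorem hdetOn_empty (A : Matrix ι ι R) : hdetOn A ∅ = 1 := by
  have hperms : permsOn (∅ : Finset ι) = {1} := by
    ext σ
    simp [mem_permsOn, Equiv.ext_iff]
  simp [hdetOn, hperms, cycleMins, cycleTerm]

theorem hdetOn_updateRow (A : Matrix ι ι R) {α : Finset ι} {j : ι} (hj : j ∉ α) (b : ι → R) :
    hdetOn (A.updateRow j b) α = hdetOn A α := by
  refine Finset.sum_congr rfl fun σ hσ => ?_
  unfold cycleTerm
  congr 2
  refine List.map_congr_left fun x hx => rowCycle_updateRow_of_not_sameCycle A (fun h => hj ?_) b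
  exact (mem_iff_of_sameCycle hσ h).mpr (Finset.mem_of_mem_filter x ((Finset.mem_sort _).mp hx))

end RelativeDeterminants

section PrincipalSubmatrices

open Equiv Equiv.Perm

variable {ι R : Type*}

theorem ofSubtype_pow_apply {p : ι → Prop} [DecidablePred p] (σ : Perm {x // p x}) (x : {x // p x})
    (t : ℕ) : ((ofSubtype σ) ^ t) (x : ι) = ((σ ^ t) x : {x // p x}) := by
  rw [← map_pow, ofSubtype_apply_coe]

theorem sameCycle_ofSubtype [Finite ι] {p : ι → Prop} [DecidablePred p] (σ : Perm {x // p x})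
    (x y : {x // p x}) : (ofSubtype σ : Perm ι).SameCycle x y ↔ σ.SameCycle x y := by
  simp only [sameCycle_iff_exists_nat_pow, ofSubtype_pow_apply, Subtype.coe_inj]

theorem rowCycle_ofSubtype [Ring R] (A : Matrix ι ι R) {p : ι → Prop} [DecidablePred p]
    (σ : Perm {x // p x}) (x : {x // p x}) :
    rowCycle A (ofSubtype σ) (x : ι) = rowCycle (A.submatrix Subtype.val Subtype.val) σ x := by
  have hp : Function.minimalPeriod (ofSubtype σ : Perm ι) (x : ι) = Function.minimalPeriod σ x :=
    minimalPeriod_congr_pow fun t => by rw [ofSubtype_pow_apply, Subtype.coe_inj]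
  simp only [rowCycle, hp, ofSubtype_pow_apply, Matrix.submatrix_apply]

variable [Fintype ι] [LinearOrder ι]

theorem mem_permsOn_iff_exists_ofSubtype {α : Finset ι} {τ : Perm ι} :
    τ ∈ permsOn α ↔ ∃ σ : Perm α, ofSubtype σ = τ := by
  rw [mem_permsOn]
  refine ⟨fun h => ?_, ?_⟩
  · have := (Perm.subtypeEquivSubtypePerm (· ∈ α)).surjective ⟨τ, h⟩
    exact this.imp fun σ hσ => congrArg Subtype.val hσ
  · rintro ⟨σ, rfl⟩ x hx
    exact ofSubtype_apply_of_not_mem σ hx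

theorem map_leaders {α : Finset ι} (σ : Perm α) (i : α) :
    (leaders σ i).map Subtype.val = (i : ι) :: otherLeaders α (ofSubtype σ) i := by
  have hσ : ofSubtype σ ∈ permsOn α := mem_permsOn_iff_exists_ofSubtype.mpr ⟨σ, rfl⟩
  have hmin (x : α) : (∀ y : ι, (ofSubtype σ : Perm ι).SameCycle x y → (x : ι) ≤ y) ↔
      ∀ y : α, σ.SameCycle x y → x ≤ y := by
    refine ⟨fun h y hy => h y ((sameCycle_ofSubtype σ x y).mpr hy), fun h y hy => ?_⟩
    lift y to α using (mem_iff_of_sameCycle hσ hy).mp x.2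
    exact h y ((sameCycle_ofSubtype σ x y).mp hy)
  have hsort (s : Finset α) :
      s.sort.map Subtype.val = (s.map (.subtype (· ∈ α))).sort :=
    ((Subtype.strictMono_coe _).strictMonoOn _).map_finsetSort (f := .subtype (· ∈ α))
  rw [leaders, otherLeaders, List.map_cons, hsort]
  congr 2
  ext x
  simp only [Finset.mem_map, Finset.mem_filter, Finset.mem_univ, true_and,
    Function.Embedding.subtype_apply]
  constructor
  · rintro ⟨x, ⟨hx, hxmin⟩, rfl⟩
    exact ⟨x.2, (sameCycle_ofSubtype σ i x).not.mpr hx, (hmin x).mpr hxmin⟩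
  · rintro ⟨hxα, hx, hxmin⟩
    exact ⟨⟨x, hxα⟩, ⟨(sameCycle_ofSubtype σ i ⟨x, hxα⟩).not.mp hx, (hmin ⟨x, hxα⟩).mp hxmin⟩, rfl⟩

variable [Ring R]

theorem rdet_submatrix (A : Matrix ι ι R) {α : Finset ι} (i : α) :
    rdet (A.submatrix Subtype.val Subtype.val : Matrix α α R) i = rdetOn A α i := by
  unfold rdet rdetOn
  refine Finset.sum_bij (fun σ _ => ofSubtype σ)
    (fun σ _ => mem_permsOn_iff_exists_ofSubtype.mpr ⟨σ, rfl⟩)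
    (fun σ _ τ _ h => ofSubtype_injective h)
    (fun τ hτ => (mem_permsOn_iff_exists_ofSubtype.mp hτ).imp fun σ h => ⟨Finset.mem_univ σ, h⟩)
    fun σ _ => ?_
  rw [← map_leaders, cycleTerm, List.length_map, List.map_map, Fintype.card_coe]
  congr 3
  ext x
  exact (rowCycle_ofSubtype A σ x).symm

theorem hdet_submatrix (A : Matrix ι ι R) (α : Finset ι) :
    hdet (A.submatrix Subtype.val Subtype.val : Matrix α α R) = hdetOn A α := by
  rw [hdet]
  split_ifs with h
  · have hα : α.Nonempty := Finset.nonempty_coe_sort.mp h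
    rw [rdet_submatrix, hdetOn_eq_rdetOn A hα]
    congr 1
    exact le_antisymm (Finset.min'_le _ (⟨_, α.min'_mem hα⟩ : α) (Finset.mem_univ _))
      (α.min'_le _ (Subtype.prop _))
  · obtain rfl : α = ∅ := by rwa [Finset.nonempty_coe_sort, Finset.not_nonempty_iff_eq_empty] at h
    rw [hdetOn_empty]

end PrincipalSubmatrices

section Adjoint

variable {ι R : Type*} [Ring R] [StarRing R]

theorem star_list_prod (l : List R) : star l.prod = (l.reverse.map star).prod := by
  induction l with
  | nil => simp
  | cons a l ih => simp [ih]

theorem star_rowCycle_conjTranspose (A : Matrix ι ι R) (σ : Equiv.Perm ι) (x : ι) :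
    star (rowCycle Aᴴ σ x) = colCycle A σ x := by
  rw [rowCycle, star_list_prod, ← List.map_reverse, List.map_map, colCycle]
  congr 1
  exact List.map_congr_left fun t _ => by simp

theorem cdet_eq_star_rdet [Fintype ι] [LinearOrder ι] (A : Matrix ι ι R) (j : ι) :
    cdet A j = star (rdet Aᴴ j) := by
  rw [cdet, rdet, star_sum]
  refine Finset.sum_congr rfl fun σ _ => ?_
  rw [star_mul, star_list_prod, ← List.map_reverse, List.map_map, star_pow, star_neg, star_one,
    ((Commute.neg_one_left _).pow_left _).eq]
  congr 2
  exact List.map_congr_left fun x _ => (star_rowCycle_conjTranspose A σ x).symm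

end Adjoint

section Cofactors

variable {ι R : Type*} [Fintype ι] [LinearOrder ι] [Ring R]

/-- The cofactors of the row determinant along `j` on the index set `α`: the coefficient of `b l` in
the determinant in which the row `j` is replaced by `b`. -/
noncomputable def cof (H : Matrix ι ι R) (α : Finset ι) (l j : ι) : R :=
  if l = j then hdetOn H (α.erase j) else -rdetOn (H.updateRow j (H l)) (α.erase l) j

/-- The determinant of the principal submatrix on `β`, bordered by the row `i` and the column `j`
of `H`, in its expansion by the cofactors on `β`. -/
noncomputable def borderedDet (H : Matrix ι ι R) (β : Finset ι) (i j : ι) : R :=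
  H i j * hdetOn H β - ∑ t ∈ β, ∑ u ∈ β, H i t * cof H β t u * H u j

theorem cof_self (H : Matrix ι ι R) (α : Finset ι) (j : ι) :
    cof H α j j = hdetOn H (α.erase j) := if_pos rfl

theorem rdetOn_updateRow (H : Matrix ι ι R) {α : Finset ι} {j : ι} (hj : j ∈ α) (b : ι → R) :
    rdetOn (H.updateRow j b) α j = ∑ l ∈ α, b l * cof H α l j := by
  rw [rdetOn_eq _ α hj, ← Finset.add_sum_erase α _ hj,
    hdetOn_updateRow _ (Finset.notMem_erase j α), cof_self, Matrix.updateRow_self]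
  congr 1
  refine Finset.sum_congr rfl fun i hi => ?_
  have hij := Finset.ne_of_mem_erase hi
  rw [cof, if_neg hij, Matrix.updateRow_ne hij, Matrix.updateRow_idem]

theorem rdetOn_eq_sum_cof (H : Matrix ι ι R) {α : Finset ι} {j : ι} (hj : j ∈ α) :
    rdetOn H α j = ∑ l ∈ α, H j l * cof H α l j := by
  rw [← rdetOn_updateRow H hj, Matrix.updateRow_eq_self]

theorem cof_eq_neg_sum_row (H : Matrix ι ι R) {α : Finset ι} {l j : ι} (hj : j ∈ α) (h : l ≠ j) :
    cof H α l j = -∑ t ∈ α.erase l, H l t * cof H (α.erase l) t j := by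
  rw [cof, if_neg h, rdetOn_updateRow H (Finset.mem_erase.mpr ⟨h.symm, hj⟩)]

theorem continuous_rdetOn [TopologicalSpace R] [IsTopologicalRing R] (α : Finset ι) (j : ι) :
    Continuous fun A : Matrix ι ι R => rdetOn A α j := by
  refine continuous_finsetSum _ fun σ _ => continuous_const.mul ?_
  refine continuous_list_prod _ fun x _ => continuous_list_prod _ fun t _ => ?_
  exact continuous_id.matrix_elem _ _

end Cofactors

section Hermitian

variable {ι : Type*}

theorem commute_of_star_eq {a : ℍ[ℝ]} (h : star a = a) (b : ℍ[ℝ]) : Commute a b := by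
  rw [Quaternion.star_eq_self.mp h]
  exact Quaternion.coe_commute _ _

variable [Fintype ι] [LinearOrder ι]

/-- The cofactor matrix of `H` on `α` is Hermitian, the determinant is real, and `H` times the
cofactor matrix is the determinant. -/
structure CofactorLaws (H : Matrix ι ι ℍ[ℝ]) (α : Finset ι) : Prop where
  star_hdetOn : star (hdetOn H α) = hdetOn H α
  star_cof : ∀ l ∈ α, ∀ j ∈ α, star (cof H α l j) = cof H α j l
  sum_mul_cof : ∀ i ∈ α, ∀ j ∈ α, ∑ l ∈ α, H i l * cof H α l j = if i = j then hdetOn H α else 0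

section Bordered

variable {H : Matrix ι ι ℍ[ℝ]} (hH : H.IsHermitian) {β : Finset ι} {i j : ι}

include hH in
theorem CofactorLaws.star_borderedDet (h : CofactorLaws H β) :
    star (borderedDet H β i j) = borderedDet H β j i := by
  rw [borderedDet, star_sub, star_mul, h.star_hdetOn, hH.apply,
    (commute_of_star_eq h.star_hdetOn _).eq, star_sum, Finset.sum_congr rfl fun t _ => star_sum _ _,
    Finset.sum_comm, borderedDet]
  congr 1
  refine Finset.sum_congr rfl fun t ht => Finset.sum_congr rfl fun u hu => ?_
  rw [star_mul, star_mul, h.star_cof u hu t ht, hH.apply, hH.apply, mul_assoc]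

theorem CofactorLaws.borderedDet_of_mem (h : CofactorLaws H β) (hi : i ∈ β) :
    borderedDet H β i j = 0 := by
  have hsum : ∀ u ∈ β, ∑ t ∈ β, H i t * cof H β t u * H u j =
      if i = u then hdetOn H β * H u j else 0 := fun u hu => by
    rw [← Finset.sum_mul, h.sum_mul_cof i hi u hu, ite_mul, zero_mul]
  rw [borderedDet, Finset.sum_comm, Finset.sum_congr rfl hsum, Finset.sum_ite_eq, if_pos hi,
    (commute_of_star_eq h.star_hdetOn _).eq, sub_self]

variable {α : Finset ι}

include hH in
theorem cof_eq_neg_sum_col (hα : ∀ l ∈ α, ∀ j ∈ α, star (cof H α l j) = cof H α j l) {l : ι}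
    (hl : l ∈ α) (hj : j ∈ α) (hne : l ≠ j) (h : CofactorLaws H (α.erase j)) :
    cof H α l j = -∑ t ∈ α.erase j, cof H (α.erase j) l t * H t j := by
  rw [← hα j hj l hl, cof_eq_neg_sum_row H hl hne.symm, star_neg, star_sum]
  congr 1
  refine Finset.sum_congr rfl fun t ht => ?_
  rw [star_mul, h.star_cof t ht l (Finset.mem_erase.mpr ⟨hne, hl⟩), hH.apply t j]

include hH in
theorem sum_mul_cof_eq_borderedDet (hα : ∀ l ∈ α, ∀ j ∈ α, star (cof H α l j) = cof H α j l)
    (hj : j ∈ α) (h : CofactorLaws H (α.erase j)) :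
    ∑ l ∈ α, H i l * cof H α l j = borderedDet H (α.erase j) i j := by
  rw [← Finset.add_sum_erase _ _ hj, cof_self, borderedDet, sub_eq_add_neg,
    ← Finset.sum_neg_distrib]
  congr 1
  refine Finset.sum_congr rfl fun l hl => ?_
  obtain ⟨hlj, hlα⟩ := Finset.mem_erase.mp hl
  rw [cof_eq_neg_sum_col hH hα hlα hj hlj h, mul_neg, Finset.mul_sum]
  simp only [mul_assoc]

end Bordered

section Induction

variable {H : Matrix ι ι ℍ[ℝ]} (hH : H.IsHermitian) {α : Finset ι}
  (ih : ∀ β, β ⊂ α → CofactorLaws H β) {i j : ι}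

include hH ih

theorem star_cof_of_ssubset : ∀ l ∈ α, ∀ j ∈ α, star (cof H α l j) = cof H α j l := by
  have hcof : ∀ l ∈ α, ∀ j ∈ α, l ≠ j →
      cof H α l j = -borderedDet H ((α.erase l).erase j) l j ∧
        CofactorLaws H ((α.erase l).erase j) := fun l hl j hj hne => by
    have hjl : j ∈ α.erase l := Finset.mem_erase.mpr ⟨hne.symm, hj⟩
    have hlaws := ih _ ((Finset.erase_ssubset hjl).trans (Finset.erase_ssubset hl))
    rw [cof_eq_neg_sum_row H hj hne,
      sum_mul_cof_eq_borderedDet hH (ih _ (Finset.erase_ssubset hl)).star_cof hjl hlaws]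
    exact ⟨rfl, hlaws⟩
  intro l hl j hj
  obtain rfl | hne := eq_or_ne l j
  · rw [cof_self, (ih _ (Finset.erase_ssubset hl)).star_hdetOn]
  · obtain ⟨hlj, hlaws⟩ := hcof l hl j hj hne
    rw [hlj, (hcof j hj l hl hne.symm).1, star_neg, hlaws.star_borderedDet hH,
      Finset.erase_right_comm]

theorem rdetOn_eq_borderedDet (hj : j ∈ α) : rdetOn H α j = borderedDet H (α.erase j) j j := by
  rw [rdetOn_eq_sum_cof H hj, sum_mul_cof_eq_borderedDet hH (star_cof_of_ssubset hH ih) hj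
    (ih _ (Finset.erase_ssubset hj))]

theorem star_rdetOn (hj : j ∈ α) : star (rdetOn H α j) = rdetOn H α j := by
  rw [rdetOn_eq_borderedDet hH ih hj, (ih _ (Finset.erase_ssubset hj)).star_borderedDet hH]

theorem sum_mul_cof_of_ssubset (hi : i ∈ α) (hj : j ∈ α) :
    ∑ l ∈ α, H i l * cof H α l j = if i = j then rdetOn H α j else 0 := by
  split_ifs with hij
  · rw [hij, rdetOn_eq_sum_cof H hj]
  · have hlaws := ih _ (Finset.erase_ssubset hj)
    rw [sum_mul_cof_eq_borderedDet hH (star_cof_of_ssubset hH ih) hj hlaws,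
      hlaws.borderedDet_of_mem (Finset.mem_erase.mpr ⟨hij, hi⟩)]

theorem sum_cof_mul_of_ssubset (hi : i ∈ α) (hj : j ∈ α) :
    ∑ l ∈ α, cof H α i l * H l j = if i = j then rdetOn H α j else 0 := by
  have h := congrArg star (sum_mul_cof_of_ssubset hH ih hj hi)
  rw [star_sum, apply_ite star, star_rdetOn hH ih hi, star_zero] at h
  calc ∑ l ∈ α, cof H α i l * H l j = ∑ l ∈ α, star (H j l * cof H α l i) := by
        refine Finset.sum_congr rfl fun l hl => ?_
        rw [star_mul, star_cof_of_ssubset hH ih l hl i hi, hH.apply]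
    _ = if i = j then rdetOn H α j else 0 := by
        rw [h]
        obtain rfl | hij := eq_or_ne i j
        · rfl
        · rw [if_neg hij, if_neg hij.symm]

-- Evaluating `∑ H i t * cof t l * H l j` in two ways gives `D_i * H i j = H i j * D_j` for the row
-- determinants `D_i` and `D_j`, which are real.
theorem rdetOn_eq_of_apply_ne_zero (hi : i ∈ α) (hj : j ∈ α) (hij : H i j ≠ 0) :
    rdetOn H α i = rdetOn H α j := by
  have hleft : ∑ l ∈ α, (∑ t ∈ α, H i t * cof H α t l) * H l j = rdetOn H α i * H i j := by
    rw [Finset.sum_congr rfl fun l hl => by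
      rw [sum_mul_cof_of_ssubset hH ih hi hl, ite_mul, zero_mul], Finset.sum_ite_eq, if_pos hi]
  have hright : ∑ t ∈ α, H i t * (∑ l ∈ α, cof H α t l * H l j) = H i j * rdetOn H α j := by
    rw [Finset.sum_congr rfl fun t ht => by
      rw [sum_cof_mul_of_ssubset hH ih ht hj, mul_ite, mul_zero], Finset.sum_ite_eq', if_pos hj]
  have hcomm : rdetOn H α i * H i j = H i j * rdetOn H α j := by
    rw [← hleft, ← hright]
    simp only [Finset.sum_mul, Finset.mul_sum]
    rw [Finset.sum_comm]
    simp only [mul_assoc]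
  rw [← (commute_of_star_eq (star_rdetOn hH ih hj) _).eq] at hcomm
  exact mul_right_cancel₀ hij hcomm

end Induction

omit [Fintype ι] [LinearOrder ι] in
theorem isHermitian_smul {H : Matrix ι ι ℍ[ℝ]} (hH : H.IsHermitian) (c : ℝ) :
    (c • H).IsHermitian :=
  .ext fun i j => by rw [Matrix.smul_apply, Matrix.smul_apply, Quaternion.star_smul, hH.apply]

-- If `H i j = 0`, the matrix is perturbed in the entries `(i, j)` and `(j, i)`.
theorem rdetOn_eq_of_isHermitian {H : Matrix ι ι ℍ[ℝ]} (hH : H.IsHermitian) {α : Finset ι}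
    (ih : ∀ β, β ⊂ α → ∀ H : Matrix ι ι ℍ[ℝ], H.IsHermitian → CofactorLaws H β) {i j : ι}
    (hi : i ∈ α) (hj : j ∈ α) : rdetOn H α i = rdetOn H α j := by
  obtain rfl | hij := eq_or_ne i j
  · rfl
  let E : Matrix ι ι ℍ[ℝ] := Matrix.single i j 1 + (Matrix.single i j 1)ᴴ
  let P : ℝ → Matrix ι ι ℍ[ℝ] := fun t => H + t • E
  have hcont : Continuous P := continuous_const.add (continuous_id.smul continuous_const)
  have hherm (t : ℝ) : (P t).IsHermitian :=
    hH.add (isHermitian_smul (Matrix.isHermitian_add_transpose_self _) t)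
  have hentry (t : ℝ) (ht : t ∈ ({-(H i j).re}ᶜ : Set ℝ)) : P t i j ≠ 0 := fun h => ht <| by
    have hre : (H i j).re + t = 0 := by
      simpa [P, E, Matrix.single, hij, hij.symm] using congrArg (·.re) h
    exact eq_neg_of_add_eq_zero_right hre
  have hEq : (fun t => rdetOn (P t) α i) = fun t => rdetOn (P t) α j :=
    ((continuous_rdetOn α i).comp hcont).ext_on (dense_compl_singleton _)
      ((continuous_rdetOn α j).comp hcont) fun t ht =>
        rdetOn_eq_of_apply_ne_zero (hherm t) (fun β hβ => ih β hβ _ (hherm t)) hi hj (hentry t ht)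
  simpa [P] using congrFun hEq 0

theorem cofactorLaws {H : Matrix ι ι ℍ[ℝ]} (hH : H.IsHermitian) (α : Finset ι) :
    CofactorLaws H α := by
  induction α using Finset.strongInduction generalizing H with
  | H α ih =>
    have ihH : ∀ β, β ⊂ α → CofactorLaws H β := fun β hβ => ih β hβ hH
    have hdet : ∀ j ∈ α, rdetOn H α j = hdetOn H α := fun j hj => by
      rw [hdetOn_eq_rdetOn H ⟨j, hj⟩]
      exact rdetOn_eq_of_isHermitian hH (fun β hβ _ hH => ih β hβ hH) hj (α.min'_mem _)
    refine ⟨?_, star_cof_of_ssubset hH ihH, fun i hi j hj => ?_⟩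
    · rcases α.eq_empty_or_nonempty with rfl | ⟨j, hj⟩
      · rw [hdetOn_empty, star_one]
      · rw [← hdet j hj, star_rdetOn hH ihH hj]
    · rw [sum_mul_cof_of_ssubset hH ihH hi hj, hdet j hj]

end Hermitian

section CofactorSums

variable {m n : ℕ} {R : Type*} [Ring R]

/-- The sum of the cofactor matrices of the principal submatrices of size `s`. -/
noncomputable def cofSum (H : Matrix (Fin n) (Fin n) R) (s : ℕ) : Matrix (Fin n) (Fin n) R :=
  Matrix.of fun l j => ∑ α ∈ Finset.univ.powersetCard s, if l ∈ α ∧ j ∈ α then cof H α l j else 0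

theorem minorSum_eq (H : Matrix (Fin n) (Fin n) R) (s : ℕ) :
    minorSum H s = ∑ α ∈ Finset.univ.powersetCard s, hdetOn H α := by
  rw [minorSum, Finset.sum_subtype (Finset.univ.powersetCard s)
    (p := fun α : Finset (Fin n) => α.card = s) (by simp [Finset.mem_powersetCard])]
  exact Finset.sum_congr rfl fun α _ => hdet_submatrix H α.1

theorem minorSum_zero (H : Matrix (Fin n) (Fin n) R) : minorSum H 0 = 1 := by
  simp [minorSum_eq, hdetOn_empty]

theorem minorSum_of_lt (H : Matrix (Fin n) (Fin n) R) {s : ℕ} (h : n < s) : minorSum H s = 0 := by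
  rw [minorSum_eq, Finset.powersetCard_eq_empty.mpr (by simpa using h), Finset.sum_empty]

theorem cofSum_zero (H : Matrix (Fin n) (Fin n) R) : cofSum H 0 = 0 := by
  ext l j
  simp [cofSum]

theorem cofSum_of_lt (H : Matrix (Fin n) (Fin n) R) {s : ℕ} (h : n < s) : cofSum H s = 0 := by
  ext1 l j
  rw [cofSum, Matrix.of_apply, Finset.powersetCard_eq_empty.mpr (by simpa using h),
    Finset.sum_empty, Matrix.zero_apply]

theorem mul_cofSum_apply (B : Matrix (Fin m) (Fin n) R) (H : Matrix (Fin n) (Fin n) R) (s : ℕ)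
    (i : Fin m) (j : Fin n) :
    (B * cofSum H s) i j = ∑ α ∈ (Finset.univ.powersetCard s).filter (fun α => j ∈ α),
      ∑ l ∈ α, B i l * cof H α l j := by
  rw [Matrix.mul_apply, Finset.sum_filter]
  simp only [cofSum, Matrix.of_apply, Finset.mul_sum]
  rw [Finset.sum_comm]
  refine Finset.sum_congr rfl fun α _ => ?_
  split_ifs with hj <;> simp [hj]

theorem rdetSums_eq_mul (H : Matrix (Fin n) (Fin n) R) (s : ℕ) (B : Matrix (Fin m) (Fin n) R) :
    rdetSums H s B = B * cofSum H s := by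
  ext i j
  rw [mul_cofSum_apply, rdetSums, Matrix.of_apply, Finset.sum_subtype _
    (p := fun α : Finset (Fin n) => α.card = s ∧ j ∈ α) (by simp [Finset.mem_powersetCard])]
  refine Finset.sum_congr rfl fun α _ => ?_
  rw [← rdetOn_updateRow H α.2.2]
  exact rdet_submatrix (H.updateRow j (B i)) (α := α.1) ⟨j, α.2.2⟩

theorem sum_powersetCard_succ_erase {ι M : Type*} [Fintype ι] [DecidableEq ι] [AddCommMonoid M]
    (s : ℕ) (i : ι) (f : Finset ι → M) :
    ∑ α ∈ (Finset.univ.powersetCard (s + 1)).filter (fun α => i ∈ α), f (α.erase i) =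
      ∑ β ∈ (Finset.univ.powersetCard s).filter (fun β => i ∉ β), f β := by
  refine Finset.sum_nbij' (fun α => α.erase i) (fun β => insert i β) ?_ ?_ ?_ ?_ fun _ _ => rfl
  all_goals simp +contextual [Finset.mem_powersetCard, Finset.insert_erase]

theorem cofSum_succ_apply_self (H : Matrix (Fin n) (Fin n) R) (s : ℕ) (j : Fin n) :
    cofSum H (s + 1) j j =
      ∑ β ∈ (Finset.univ.powersetCard s).filter (fun β => j ∉ β), hdetOn H β := by
  rw [← sum_powersetCard_succ_erase, Finset.sum_filter, cofSum, Matrix.of_apply]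
  simp only [and_self, cof_self]

theorem cofSum_succ_apply_of_ne (H : Matrix (Fin n) (Fin n) R) (s : ℕ) {i j : Fin n} (h : i ≠ j) :
    cofSum H (s + 1) i j = -∑ β ∈ (Finset.univ.powersetCard s).filter (fun β => i ∉ β),
      if j ∈ β then ∑ l ∈ β, H i l * cof H β l j else 0 := by
  rw [← sum_powersetCard_succ_erase, Finset.sum_filter, cofSum, Matrix.of_apply,
    ← Finset.sum_neg_distrib]
  refine Finset.sum_congr rfl fun α _ => ?_
  by_cases hi : i ∈ α <;> by_cases hj : j ∈ α
  · simp [hi, hj, h.symm, cof_eq_neg_sum_row H hj h]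
  all_goals simp [hi, hj]

end CofactorSums

section HermitianCofactorSums

variable {m n : ℕ} {H : Matrix (Fin n) (Fin n) ℍ[ℝ]} (hH : H.IsHermitian)

include hH

theorem star_minorSum (s : ℕ) : star (minorSum H s) = minorSum H s := by
  rw [minorSum_eq, star_sum]
  exact Finset.sum_congr rfl fun α _ => (cofactorLaws hH α).star_hdetOn

theorem isHermitian_cofSum (s : ℕ) : (cofSum H s).IsHermitian := by
  refine .ext fun l j => ?_
  rw [cofSum, Matrix.of_apply, Matrix.of_apply, star_sum]
  refine Finset.sum_congr rfl fun α _ => ?_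
  by_cases h : l ∈ α ∧ j ∈ α
  · rw [if_pos h, if_pos h.symm, (cofactorLaws hH α).star_cof j h.2 l h.1]
  · rw [if_neg h, if_neg (mt And.symm h), star_zero]

theorem cdetSums_eq_mul (s : ℕ) (C : Matrix (Fin n) (Fin m) ℍ[ℝ]) :
    cdetSums H s C = cofSum H s * C := by
  suffices h : cdetSums H s C = (rdetSums H s Cᴴ)ᴴ by
    rw [h, rdetSums_eq_mul, Matrix.conjTranspose_mul, Matrix.conjTranspose_conjTranspose,
      (isHermitian_cofSum hH s).eq]
  ext1 i j
  rw [Matrix.conjTranspose_apply, cdetSums, rdetSums, Matrix.of_apply, Matrix.of_apply, star_sum]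
  refine Finset.sum_congr rfl fun α _ => ?_
  have hrow : (principal (H.updateCol i fun l => C l j) α.1)ᴴ =
      principal (H.updateRow i fun l => Cᴴ j l) α.1 := by
    rw [principal, Matrix.conjTranspose_submatrix, ← Matrix.updateRow_conjTranspose, hH.eq]
    rfl
  rw [cdet_eq_star_rdet, hrow]

theorem mul_cofSum_apply_self (s : ℕ) (j : Fin n) :
    (H * cofSum H s) j j =
      ∑ α ∈ (Finset.univ.powersetCard s).filter (fun α => j ∈ α), hdetOn H α := by
  rw [mul_cofSum_apply]
  refine Finset.sum_congr rfl fun α hα => ?_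
  have hj := (Finset.mem_filter.mp hα).2
  rw [(cofactorLaws hH α).sum_mul_cof j hj j hj, if_pos rfl]

theorem mul_cofSum_apply_of_ne (s : ℕ) {i j : Fin n} (hij : i ≠ j) :
    (H * cofSum H s) i j = ∑ β ∈ (Finset.univ.powersetCard s).filter (fun β => i ∉ β),
      if j ∈ β then ∑ l ∈ β, H i l * cof H β l j else 0 := by
  rw [mul_cofSum_apply, Finset.sum_filter, Finset.sum_filter]
  refine Finset.sum_congr rfl fun α _ => ?_
  by_cases hi : i ∈ α <;> by_cases hj : j ∈ α
  · simp [hi, hj, hij, (cofactorLaws hH α).sum_mul_cof i hi j hj]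
  all_goals simp [hi, hj]

/-- The recursion of the Faddeev-LeVerrier algorithm. -/
theorem mul_cofSum_add_cofSum_succ (s : ℕ) :
    H * cofSum H s + cofSum H (s + 1) = Matrix.scalar (Fin n) (minorSum H s) := by
  ext1 i j
  rw [Matrix.add_apply, Matrix.scalar_apply]
  obtain rfl | hij := eq_or_ne i j
  · rw [mul_cofSum_apply_self hH, cofSum_succ_apply_self, Matrix.diagonal_apply_eq, minorSum_eq,
      Finset.sum_filter_add_sum_filter_not]
  · rw [mul_cofSum_apply_of_ne hH s hij, cofSum_succ_apply_of_ne H s hij, add_neg_cancel,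
      Matrix.diagonal_apply_ne _ hij]

theorem trace_mul_cofSum (s : ℕ) : (H * cofSum H s).trace = s * minorSum H s := by
  simp only [Matrix.trace, Matrix.diag_apply, mul_cofSum_apply_self hH, Finset.sum_filter]
  rw [Finset.sum_comm, minorSum_eq, Finset.mul_sum]
  refine Finset.sum_congr rfl fun α hα => ?_
  rw [← Finset.sum_filter, Finset.sum_const, Finset.filter_univ_mem,
    (Finset.mem_powersetCard.mp hα).2, nsmul_eq_mul]

end HermitianCofactorSums

section Rank

variable {l m n : ℕ}

theorem mem_rowSpan_iff {A : Matrix (Fin m) (Fin n) ℍ[ℝ]} {v : Fin n → ℍ[ℝ]} :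
    v ∈ Submodule.span ℍ[ℝ] (Set.range fun i => A i) ↔ ∃ z : Fin m → ℍ[ℝ], z ᵥ* A = v := by
  simp only [Submodule.mem_span_range_iff_exists_fun, Matrix.vecMul_eq_sum]

theorem rowSpan_le_iff {A : Matrix (Fin m) (Fin n) ℍ[ℝ]} {B : Matrix (Fin l) (Fin n) ℍ[ℝ]} :
    Submodule.span ℍ[ℝ] (Set.range fun i => B i) ≤ Submodule.span ℍ[ℝ] (Set.range fun i => A i) ↔
      ∃ Z : Matrix (Fin l) (Fin m) ℍ[ℝ], Z * A = B := by
  rw [Submodule.span_le]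
  constructor
  · intro h
    choose Z hZ using fun i => mem_rowSpan_iff.mp (h ⟨i, rfl⟩)
    exact ⟨Matrix.of Z, funext hZ⟩
  · rintro ⟨Z, rfl⟩ _ ⟨i, rfl⟩
    exact mem_rowSpan_iff.mpr ⟨Z i, rfl⟩

theorem rk_mul_le (Z : Matrix (Fin l) (Fin m) ℍ[ℝ]) (A : Matrix (Fin m) (Fin n) ℍ[ℝ]) :
    rk (Z * A) ≤ rk A :=
  Submodule.finrank_mono (rowSpan_le_iff.mpr ⟨Z, rfl⟩)

theorem rk_mul_eq_iff {Z : Matrix (Fin l) (Fin m) ℍ[ℝ]} {A : Matrix (Fin m) (Fin n) ℍ[ℝ]} :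
    rk (Z * A) = rk A ↔ ∃ Y : Matrix (Fin m) (Fin l) ℍ[ℝ], Y * (Z * A) = A := by
  constructor
  · intro h
    exact rowSpan_le_iff.mp
      (Submodule.eq_of_le_of_finrank_eq (rowSpan_le_iff.mpr ⟨Z, rfl⟩) h).ge
  · rintro ⟨Y, hY⟩
    exact (rk_mul_le Z A).antisymm ((congrArg rk hY).symm.trans_le (rk_mul_le Y _))

theorem exists_fullRank_factorization (A : Matrix (Fin m) (Fin n) ℍ[ℝ]) :
    ∃ (F : Matrix (Fin m) (Fin (rk A)) ℍ[ℝ]) (G : Matrix (Fin (rk A)) (Fin n) ℍ[ℝ])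
      (Z : Matrix (Fin (rk A)) (Fin m) ℍ[ℝ]),
      F * G = A ∧ Z * A = G ∧ LinearIndependent ℍ[ℝ] G.row := by
  let V := Submodule.span ℍ[ℝ] (Set.range fun i => A i)
  let b : Module.Basis (Fin (rk A)) ℍ[ℝ] V := Module.finBasis ℍ[ℝ] V
  let G : Matrix (Fin (rk A)) (Fin n) ℍ[ℝ] := Matrix.of fun a => (b a : Fin n → ℍ[ℝ])
  have hspan : Submodule.span ℍ[ℝ] (Set.range fun a => G a) = V := by
    have hmap := congrArg (Submodule.map V.subtype) b.span_eq
    rwa [Submodule.map_span, ← Set.range_comp, Submodule.map_subtype_top] at hmap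
  obtain ⟨F, hF⟩ := rowSpan_le_iff.mp hspan.ge
  obtain ⟨Z, hZ⟩ := rowSpan_le_iff.mp hspan.le
  exact ⟨F, G, Z, hF, hZ, b.linearIndependent.map' V.subtype (Submodule.ker_subtype V)⟩

theorem re_sum {ι : Type*} (s : Finset ι) (f : ι → ℍ[ℝ]) : (∑ i ∈ s, f i).re = ∑ i ∈ s, (f i).re :=
  map_sum (QuaternionAlgebra.reₗ (-1 : ℝ) 0 (-1)) f s

theorem re_trace_mul_comm (X : Matrix (Fin m) (Fin n) ℍ[ℝ]) (Y : Matrix (Fin n) (Fin m) ℍ[ℝ]) :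
    (X * Y).trace.re = (Y * X).trace.re := by
  simp only [Matrix.trace, Matrix.diag_apply, Matrix.mul_apply, re_sum]
  rw [Finset.sum_comm]
  refine Finset.sum_congr rfl fun i _ => Finset.sum_congr rfl fun j _ => ?_
  simp only [Quaternion.re_mul]
  ring

theorem re_trace_mul_eq_rk {A : Matrix (Fin m) (Fin n) ℍ[ℝ]} {X : Matrix (Fin n) (Fin m) ℍ[ℝ]}
    (hX : A * X * A = A) : (A * X).trace.re = rk A := by
  obtain ⟨F, G, Z, hF, hZ, hG⟩ := exists_fullRank_factorization A
  have hGXFG : G * X * F * G = G := by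
    rw [Matrix.mul_assoc, hF, ← hZ, Matrix.mul_assoc, Matrix.mul_assoc, ← Matrix.mul_assoc A, hX]
  have hGXF : G * X * F = 1 := by
    refine funext fun a => Matrix.vecMul_injective_iff.mpr hG ?_
    exact congrFun (hGXFG.trans (Matrix.one_mul G).symm) a
  calc (A * X).trace.re = (F * (G * X)).trace.re := by rw [← Matrix.mul_assoc, hF]
    _ = (G * X * F).trace.re := re_trace_mul_comm _ _
    _ = rk A := by rw [hGXF, Matrix.trace_one, Fintype.card_fin, Quaternion.re_natCast]

theorem rk_conjTranspose_of_mul_mul_eq {A : Matrix (Fin m) (Fin n) ℍ[ℝ]}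
    {X : Matrix (Fin n) (Fin m) ℍ[ℝ]} (hX : A * X * A = A) : rk Aᴴ = rk A := by
  have hX' : Aᴴ * Xᴴ * Aᴴ = Aᴴ := by
    simp only [← Matrix.conjTranspose_mul, ← Matrix.mul_assoc, hX]
  have htr : (rk Aᴴ : ℝ) = rk A := by
    rw [← re_trace_mul_eq_rk hX', ← Matrix.conjTranspose_mul, Matrix.trace_conjTranspose,
      Quaternion.re_star, re_trace_mul_comm, re_trace_mul_eq_rk hX]
  exact_mod_cast htr

end Rank

section Cancellation

variable {l m n : ℕ}

theorem eq_zero_of_conjTranspose_mul_self {X : Matrix (Fin m) (Fin n) ℍ[ℝ]} (h : Xᴴ * X = 0) :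
    X = 0 := by
  ext1 i j
  have hsum : (∑ k, star (X k j) * X k j).re = 0 := congrArg (·.re) (congrFun (congrFun h j) j)
  simp only [re_sum, Quaternion.star_mul_self, Quaternion.re_coe] at hsum
  rw [Finset.sum_eq_zero_iff_of_nonneg fun _ _ => Quaternion.normSq_nonneg] at hsum
  exact Quaternion.normSq_eq_zero.mp (hsum i (Finset.mem_univ i))

theorem mul_eq_zero_of_conjTranspose_mul_mul {A : Matrix (Fin m) (Fin n) ℍ[ℝ]}
    {Y : Matrix (Fin n) (Fin l) ℍ[ℝ]} (h : Aᴴ * A * Y = 0) : A * Y = 0 := by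
  apply eq_zero_of_conjTranspose_mul_self
  rw [Matrix.conjTranspose_mul, Matrix.mul_assoc, ← Matrix.mul_assoc Aᴴ, h, Matrix.mul_zero]

theorem mul_eq_zero_of_pow_mul {H : Matrix (Fin n) (Fin n) ℍ[ℝ]} (hH : H.IsHermitian)
    {X : Matrix (Fin n) (Fin l) ℍ[ℝ]} (q : ℕ) (h : H ^ q * X = 0) : H * X = 0 := by
  induction q with
  | zero => rw [← Matrix.one_mul X, ← pow_zero H, h, Matrix.mul_zero]
  | succ q ih =>
    rcases q with _ | q
    · rwa [zero_add, pow_one] at h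
    · refine ih (mul_eq_zero_of_conjTranspose_mul_mul ?_)
      rw [(hH.pow (q + 1)).eq, ← pow_add, show q + 1 + (q + 1) = q + (q + 1 + 1) by ring, pow_add,
        Matrix.mul_assoc, h, Matrix.mul_zero]

end Cancellation

section HermitianRank

variable {n : ℕ} {H : Matrix (Fin n) (Fin n) ℍ[ℝ]} (hH : H.IsHermitian)

include hH

theorem minorSum_eq_coe (s : ℕ) : minorSum H s = ((minorSum H s).re : ℍ[ℝ]) :=
  Quaternion.star_eq_self.mp (star_minorSum hH s)

theorem cofSum_succ (s : ℕ) :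
    cofSum H (s + 1) = (minorSum H s).re • 1 - H * cofSum H s := by
  have hscalar : Matrix.scalar (Fin n) (minorSum H s) = (minorSum H s).re • 1 := by
    rw [minorSum_eq_coe hH, Quaternion.re_coe]
    ext1 i j
    rw [Matrix.scalar_apply, Matrix.diagonal_apply, Matrix.smul_apply, Matrix.one_apply, smul_ite,
      smul_zero, ← Quaternion.algebraMap_def, Algebra.algebraMap_eq_smul_one]
  rw [eq_sub_iff_add_eq', mul_cofSum_add_cofSum_succ hH, hscalar]

theorem commute_cofSum {Y : Matrix (Fin n) (Fin n) ℍ[ℝ]} (hY : Commute Y H) (s : ℕ) :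
    Commute Y (cofSum H s) := by
  induction s with
  | zero => rw [cofSum_zero]; exact Commute.zero_right _
  | succ s ih =>
    rw [cofSum_succ hH]
    exact ((Commute.one_right _).smul_right _).sub_right (hY.mul_right ih)

theorem re_trace_mul_cofSum (s : ℕ) : (H * cofSum H s).trace.re = s * (minorSum H s).re := by
  rw [trace_mul_cofSum hH, minorSum_eq_coe hH, ← Quaternion.coe_natCast, ← Quaternion.coe_mul,
    Quaternion.re_coe, Quaternion.re_coe]

theorem cofSum_add_of_re_minorSum_eq_zero {q : ℕ} (hq : ∀ s, q < s → (minorSum H s).re = 0)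
    (t : ℕ) : cofSum H (q + 1 + t) = (-H) ^ t * cofSum H (q + 1) := by
  induction t with
  | zero => rw [add_zero, pow_zero, one_mul]
  | succ t ih =>
    rw [← add_assoc, cofSum_succ hH, hq _ (by lia), zero_smul, zero_sub, ih, pow_succ', mul_assoc,
      neg_mul]

theorem exists_re_minorSum_ne_zero :
    ∃ q, (minorSum H q).re ≠ 0 ∧ H * cofSum H (q + 1) = 0 := by
  classical
  let q := Nat.findGreatest (fun s => (minorSum H s).re ≠ 0) n
  have hne : (minorSum H q).re ≠ 0 :=
    Nat.findGreatest_spec (P := fun s => (minorSum H s).re ≠ 0) (Nat.zero_le n)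
      (by rw [minorSum_zero]; exact one_ne_zero)
  have hzero (s : ℕ) (hs : q < s) : (minorSum H s).re = 0 := by
    rcases le_or_gt s n with hsn | hsn
    · exact not_not.mp (Nat.findGreatest_is_greatest hs hsn)
    · rw [minorSum_of_lt H hsn]
      rfl
  refine ⟨q, hne, ?_⟩
  have hpow : (-H) ^ n * cofSum H (q + 1) = 0 := by
    rw [← cofSum_add_of_re_minorSum_eq_zero hH hzero, cofSum_of_lt H (by lia)]
  rw [← neg_eq_zero, ← neg_mul]
  exact mul_eq_zero_of_pow_mul hH.neg n hpow

theorem mul_mul_cofSum_of_mul_cofSum_succ_eq_zero {q : ℕ} (hq : H * cofSum H (q + 1) = 0) :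
    H * (H * cofSum H q) = (minorSum H q).re • H := by
  rw [cofSum_succ hH, mul_sub, mul_smul_comm, mul_one, sub_eq_zero] at hq
  exact hq.symm

theorem rk_eq_of_mul_cofSum_succ_eq_zero {q : ℕ} (hne : (minorSum H q).re ≠ 0)
    (hq : H * cofSum H (q + 1) = 0) : rk H = q := by
  have hinner : H * ((minorSum H q).re⁻¹ • cofSum H q) * H = H := by
    rw [mul_smul_comm, smul_mul_assoc, mul_assoc, ← (commute_cofSum hH (Commute.refl H) q).eq,
      mul_mul_cofSum_of_mul_cofSum_succ_eq_zero hH hq, smul_smul, inv_mul_cancel₀ hne, one_smul]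
  have htr := re_trace_mul_eq_rk hinner
  rw [mul_smul_comm, Matrix.trace_smul, Quaternion.re_smul, re_trace_mul_cofSum hH, smul_eq_mul,
    mul_left_comm, inv_mul_cancel₀ hne, mul_one] at htr
  exact_mod_cast htr.symm

theorem re_minorSum_rk_ne_zero : (minorSum H (rk H)).re ≠ 0 := by
  obtain ⟨q, hne, hq⟩ := exists_re_minorSum_ne_zero hH
  rwa [rk_eq_of_mul_cofSum_succ_eq_zero hH hne hq]

theorem mul_mul_cofSum_rk : H * (H * cofSum H (rk H)) = (minorSum H (rk H)).re • H := by
  obtain ⟨q, hne, hq⟩ := exists_re_minorSum_ne_zero hH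
  rw [rk_eq_of_mul_cofSum_succ_eq_zero hH hne hq]
  exact mul_mul_cofSum_of_mul_cofSum_succ_eq_zero hH hq

theorem exists_isHermitian_commute_mul_mul_eq :
    ∃ G : Matrix (Fin n) (Fin n) ℍ[ℝ], G.IsHermitian ∧ Commute H G ∧ H * (H * G) = H := by
  refine ⟨(minorSum H (rk H)).re⁻¹ • cofSum H (rk H), isHermitian_smul (isHermitian_cofSum hH _) _,
    (commute_cofSum hH (Commute.refl H) _).smul_right _, ?_⟩
  rw [mul_smul_comm, mul_smul_comm, mul_mul_cofSum_rk hH, smul_smul,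
    inv_mul_cancel₀ (re_minorSum_rk_ne_zero hH), one_smul]

theorem mul_cofSum_rk_eq_smul {E T : Matrix (Fin n) (Fin n) ℍ[ℝ]} (hE : E * H = H)
    (hT : T * H = E) : H * cofSum H (rk H) = (minorSum H (rk H)).re • E :=
  calc H * cofSum H (rk H) = T * (H * (H * cofSum H (rk H))) := by
        rw [← mul_assoc, hT, ← mul_assoc, hE]
    _ = (minorSum H (rk H)).re • E := by rw [mul_mul_cofSum_rk hH, mul_smul_comm, hT]

end HermitianRank

section MoorePenrose

variable {m n : ℕ} {A : Matrix (Fin m) (Fin n) ℍ[ℝ]}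

theorem exists_isMoorePenrose (A : Matrix (Fin m) (Fin n) ℍ[ℝ]) : ∃ X, IsMoorePenrose A X := by
  have hK := Matrix.isHermitian_conjTranspose_mul_self A
  obtain ⟨G, hG, hcomm, hKKG⟩ := exists_isHermitian_commute_mul_mul_eq hK
  have hAKG : A * (Aᴴ * A * G) = A := by
    have hzero : A * (Aᴴ * A * G - 1) = 0 :=
      mul_eq_zero_of_conjTranspose_mul_mul (by rw [mul_sub_one, hKKG, sub_self])
    rwa [Matrix.mul_sub, Matrix.mul_one, sub_eq_zero] at hzero
  have hGKA : G * (Aᴴ * A) * Aᴴ = Aᴴ := by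
    simpa only [Matrix.conjTranspose_mul, hK.eq, hG.eq] using congrArg Matrix.conjTranspose hAKG
  refine ⟨G * Aᴴ, ?_, ?_, ?_, ?_⟩
  · rw [Matrix.mul_assoc, Matrix.mul_assoc, ← hcomm.eq, hAKG]
  · calc G * Aᴴ * A * (G * Aᴴ) = G * (Aᴴ * A * G) * Aᴴ := by simp only [Matrix.mul_assoc]
      _ = G * Aᴴ := by rw [hcomm.eq, Matrix.mul_assoc, hGKA]
  · simp only [Matrix.conjTranspose_mul, Matrix.conjTranspose_conjTranspose, hG.eq,
      Matrix.mul_assoc]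
  · rw [Matrix.mul_assoc, Matrix.conjTranspose_mul, hK.eq, hG.eq, hcomm.eq]

theorem IsMoorePenrose.eq {X Y : Matrix (Fin n) (Fin m) ℍ[ℝ]} (hX : IsMoorePenrose A X)
    (hY : IsMoorePenrose A Y) : X = Y := by
  obtain ⟨hAXA, hXAX, hAX, hXA⟩ := hX
  obtain ⟨hAYA, hYAY, hAY, hYA⟩ := hY
  have hleft : A * X = A * Y :=
    calc A * X = (A * Y)ᴴ * (A * X)ᴴ := by rw [hAX, hAY, ← Matrix.mul_assoc, hAYA]
      _ = A * Y := by rw [← Matrix.conjTranspose_mul, ← Matrix.mul_assoc, hAXA, hAY]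
  have hright : X * A = Y * A :=
    calc X * A = (X * A)ᴴ * (Y * A)ᴴ := by
          rw [hXA, hYA, Matrix.mul_assoc, ← Matrix.mul_assoc A, hAYA]
      _ = Y * A := by
          rw [← Matrix.conjTranspose_mul, Matrix.mul_assoc, ← Matrix.mul_assoc A, hAXA, hYA]
  rw [← hXAX, Matrix.mul_assoc, hleft, ← Matrix.mul_assoc, hright, hYAY]

theorem isMoorePenrose_mpInv (A : Matrix (Fin m) (Fin n) ℍ[ℝ]) : IsMoorePenrose A (mpInv A) := by
  rw [mpInv, dif_pos (exists_isMoorePenrose A)]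
  exact (exists_isMoorePenrose A).choose_spec

theorem rk_conjTranspose (A : Matrix (Fin m) (Fin n) ℍ[ℝ]) : rk Aᴴ = rk A :=
  rk_conjTranspose_of_mul_mul_eq (isMoorePenrose_mpInv A).1

theorem conjTranspose_mpInv_mul_conjTranspose (A : Matrix (Fin m) (Fin n) ℍ[ℝ]) :
    (mpInv A)ᴴ * Aᴴ = A * mpInv A := by
  rw [← Matrix.conjTranspose_mul, (isMoorePenrose_mpInv A).2.2.1]

theorem conjTranspose_mpInv_mul_gram (A : Matrix (Fin m) (Fin n) ℍ[ℝ]) :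
    (mpInv A)ᴴ * (Aᴴ * A) = A := by
  rw [← Matrix.mul_assoc, conjTranspose_mpInv_mul_conjTranspose, (isMoorePenrose_mpInv A).1]

theorem mpInv_mul_mul_conjTranspose (A : Matrix (Fin m) (Fin n) ℍ[ℝ]) :
    mpInv A * (A * Aᴴ) = Aᴴ := by
  obtain ⟨hAXA, _, _, hXA⟩ := isMoorePenrose_mpInv A
  rw [← Matrix.mul_assoc, ← hXA, ← Matrix.conjTranspose_mul, ← Matrix.mul_assoc, hAXA]

theorem rk_conjTranspose_mul_self (A : Matrix (Fin m) (Fin n) ℍ[ℝ]) : rk (Aᴴ * A) = rk A :=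
  rk_mul_eq_iff.mpr ⟨(mpInv A)ᴴ, conjTranspose_mpInv_mul_gram A⟩

theorem rk_self_mul_conjTranspose (A : Matrix (Fin m) (Fin n) ℍ[ℝ]) : rk (A * Aᴴ) = rk A := by
  rw [rk_mul_eq_iff.mpr ⟨mpInv A, mpInv_mul_mul_conjTranspose A⟩, rk_conjTranspose]

end MoorePenrose

section Gram

variable {m n : ℕ} (A : Matrix (Fin m) (Fin n) ℍ[ℝ])

theorem gram_mul_cofSum_rk :
    Aᴴ * A * cofSum (Aᴴ * A) (rk A) = (minorSum (Aᴴ * A) (rk A)).re • (mpInv A * A) := by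
  have hE : mpInv A * A * (Aᴴ * A) = Aᴴ * A := by
    rw [← Matrix.mul_assoc, Matrix.mul_assoc _ A, mpInv_mul_mul_conjTranspose]
  have hT : mpInv A * (mpInv A)ᴴ * (Aᴴ * A) = mpInv A * A := by
    rw [Matrix.mul_assoc, conjTranspose_mpInv_mul_gram]
  simpa only [rk_conjTranspose_mul_self] using
    mul_cofSum_rk_eq_smul (Matrix.isHermitian_conjTranspose_mul_self A) hE hT

theorem cogram_mul_cofSum_rk :
    A * Aᴴ * cofSum (A * Aᴴ) (rk A) = (minorSum (A * Aᴴ) (rk A)).re • (A * mpInv A) := by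
  have hE : A * mpInv A * (A * Aᴴ) = A * Aᴴ := by
    rw [← Matrix.mul_assoc, (isMoorePenrose_mpInv A).1]
  have hT : (mpInv A)ᴴ * mpInv A * (A * Aᴴ) = A * mpInv A := by
    rw [Matrix.mul_assoc, mpInv_mul_mul_conjTranspose, conjTranspose_mpInv_mul_conjTranspose]
  simpa only [rk_self_mul_conjTranspose] using
    mul_cofSum_rk_eq_smul (Matrix.isHermitian_mul_conjTranspose_self A) hE hT

theorem mul_cofSum_gram_succ {s : ℕ} (hcof : A * cofSum (Aᴴ * A) s = cofSum (A * Aᴴ) s * A)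
    (hminor : minorSum (Aᴴ * A) s = minorSum (A * Aᴴ) s) :
    A * cofSum (Aᴴ * A) (s + 1) = cofSum (A * Aᴴ) (s + 1) * A := by
  rw [cofSum_succ (Matrix.isHermitian_conjTranspose_mul_self A),
    cofSum_succ (Matrix.isHermitian_mul_conjTranspose_self A), hminor, Matrix.mul_sub,
    Matrix.sub_mul, Matrix.mul_smul, Matrix.smul_mul, Matrix.mul_one, Matrix.one_mul]
  simp only [Matrix.mul_assoc]
  rw [hcof]

theorem re_minorSum_gram_of_mul_cofSum {s : ℕ}
    (hcof : A * cofSum (Aᴴ * A) s = cofSum (A * Aᴴ) s * A) :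
    s * (minorSum (Aᴴ * A) s).re = s * (minorSum (A * Aᴴ) s).re := by
  have hK := Matrix.isHermitian_conjTranspose_mul_self A
  have hK' := Matrix.isHermitian_mul_conjTranspose_self A
  rw [← re_trace_mul_cofSum hK, Matrix.mul_assoc, hcof, re_trace_mul_comm, Matrix.mul_assoc,
    ← (commute_cofSum hK' (Commute.refl _) s).eq, re_trace_mul_cofSum hK']

theorem minorSum_gram (s : ℕ) : minorSum (Aᴴ * A) s = minorSum (A * Aᴴ) s := by
  suffices h : A * cofSum (Aᴴ * A) s = cofSum (A * Aᴴ) s * A ∧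
    minorSum (Aᴴ * A) s = minorSum (A * Aᴴ) s from h.2
  induction s with
  | zero => simp only [cofSum_zero, minorSum_zero, Matrix.mul_zero, Matrix.zero_mul, and_self]
  | succ s ih =>
    have hcof := mul_cofSum_gram_succ A ih.1 ih.2
    have hre := mul_left_cancel₀ (Nat.cast_ne_zero.mpr s.succ_ne_zero)
      (re_minorSum_gram_of_mul_cofSum A hcof)
    rw [minorSum_eq_coe (Matrix.isHermitian_conjTranspose_mul_self A), hre,
      ← minorSum_eq_coe (Matrix.isHermitian_mul_conjTranspose_self A)]
    exact ⟨hcof, rfl⟩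

theorem re_minorSum_gram_ne_zero : (minorSum (Aᴴ * A) (rk A)).re ≠ 0 := by
  simpa only [rk_conjTranspose_mul_self] using
    re_minorSum_rk_ne_zero (Matrix.isHermitian_conjTranspose_mul_self A)

end Gram

section DrazinInverse

/-- `Y` is a Drazin inverse of `B`; the exponent `l` need only bound the index of `B` from above. -/
structure IsDrazin {M : Type*} [Monoid M] (B : M) (l : ℕ) (Y : M) : Prop where
  comm : Commute B Y
  mul_mul_self : Y * (B * Y) = Y
  pow_succ_mul : B ^ (l + 1) * Y = B ^ l

namespace IsDrazin

variable {M : Type*} [Monoid M] {B Y Z : M} {l : ℕ}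

theorem isIdempotentElem_mul (h : IsDrazin B l Y) : IsIdempotentElem (B * Y) := by
  rw [IsIdempotentElem, mul_assoc, h.mul_mul_self]

theorem pow_mul_pow (h : IsDrazin B l Y) (s : ℕ) : B ^ (s + 1) * Y ^ (s + 1) = B * Y := by
  rw [← h.comm.mul_pow, h.isIdempotentElem_mul.pow_succ_eq]

theorem mul_eq_mul (hY : IsDrazin B l Y) (hZ : IsDrazin B l Z) : B * Y = B * Z := by
  have hBZ : B ^ (l + 1) * (B * Z) = B ^ (l + 1) := by
    rw [← mul_assoc, ← pow_succ, pow_succ' B (l + 1), mul_assoc, hZ.pow_succ_mul, ← pow_succ']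
  have hBY : B * Y * B ^ (l + 1) = B ^ (l + 1) := by
    rw [((Commute.refl B).mul_left hY.comm.symm).pow_right (l + 1) |>.eq, ← mul_assoc, ← pow_succ,
      pow_succ' B (l + 1), mul_assoc, hY.pow_succ_mul, ← pow_succ']
  calc B * Y = Y ^ (l + 1) * B ^ (l + 1) := by
        rw [← hY.pow_mul_pow l, (hY.comm.pow_pow _ _).eq]
    _ = B * Y * (B * Z) := by
        rw [← hBZ, ← mul_assoc, ← (hY.comm.pow_pow _ _).eq, hY.pow_mul_pow]
    _ = B * Z := by rw [← hZ.pow_mul_pow l, ← mul_assoc, hBY]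

theorem eq (hY : IsDrazin B l Y) (hZ : IsDrazin B l Z) : Y = Z := by
  have h := hY.mul_eq_mul hZ
  rw [← hY.mul_mul_self, h, ← mul_assoc, ← hY.comm.eq, h, hZ.comm.eq, mul_assoc, hZ.mul_mul_self]

end IsDrazin

section StronglyPiRegular

variable {M : Type*} [Monoid M] {B Z : M} {l : ℕ}

theorem pow_mul_pow_add (hZ : Z * B ^ (l + 1) = B ^ l) (t : ℕ) : Z ^ t * B ^ (l + t) = B ^ l := by
  induction t with
  | zero => rw [pow_zero, one_mul, add_zero]
  | succ t ih =>
    rw [pow_succ, show l + (t + 1) = l + 1 + t by ring, pow_add, mul_assoc, ← mul_assoc Z, hZ,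
      ← pow_add, ih]

theorem pow_add_mul_pow (hZ : B ^ (l + 1) * Z = B ^ l) (t : ℕ) : B ^ (l + t) * Z ^ t = B ^ l := by
  induction t with
  | zero => rw [pow_zero, mul_one, add_zero]
  | succ t ih =>
    rw [pow_succ', show l + (t + 1) = t + (l + 1) by ring, pow_add, mul_assoc, ← mul_assoc _ Z,
      hZ, ← mul_assoc, ← pow_add, add_comm t, ih]

theorem exists_isDrazin_of_pow_eq {Z' : M} (hZ : Z * B ^ (l + 1) = B ^ l)
    (hZ' : B ^ (l + 1) * Z' = B ^ l) : ∃ Y, IsDrazin B l Y := by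
  have hleft : Z ^ (l + 1) * B ^ (l + (l + 1)) = B ^ l := pow_mul_pow_add hZ (l + 1)
  have hright : B ^ (l + (l + 1)) * Z' ^ (l + 1) = B ^ l := pow_add_mul_pow hZ' (l + 1)
  have hY : Z ^ (l + 1) * B ^ l = B ^ l * Z' ^ (l + 1) :=
    calc Z ^ (l + 1) * B ^ l = Z ^ (l + 1) * (B ^ (l + (l + 1)) * Z' ^ (l + 1)) := by rw [hright]
      _ = B ^ l * Z' ^ (l + 1) := by rw [← mul_assoc, hleft]
  have hcomm : B * (B ^ l * Z' ^ (l + 1)) = Z ^ (l + 1) * B ^ l * B :=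
    calc B * (B ^ l * Z' ^ (l + 1)) = Z ^ (l + 1) * B ^ (l + (l + 1)) * B * Z' ^ (l + 1) := by
          rw [hleft, ← mul_assoc, ← pow_succ, ← pow_succ']
      _ = Z ^ (l + 1) * (B * (B ^ (l + (l + 1)) * Z' ^ (l + 1))) := by
          rw [mul_assoc _ _ B, pow_mul_comm']
          simp only [mul_assoc]
      _ = Z ^ (l + 1) * B ^ l * B := by rw [hright, ← pow_succ', mul_assoc, ← pow_succ]
  refine ⟨B ^ l * Z' ^ (l + 1), ?_, ?_, ?_⟩
  · rw [commute_iff_eq, hcomm, hY]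
  · rw [← mul_assoc B, ← pow_succ', ← hY, mul_assoc, ← mul_assoc _ (B ^ (l + 1)), ← pow_add, hright]
  · rw [← mul_assoc, ← pow_add, add_comm, hright]

end StronglyPiRegular

end DrazinInverse

section MatrixDrazinInverse

variable {m n : ℕ}

theorem exists_pos_rk_pow_succ_eq (B : Matrix (Fin n) (Fin n) ℍ[ℝ]) :
    ∃ k, 0 < k ∧ rk (B ^ (k + 1)) = rk (B ^ k) := by
  by_contra! h
  have hlt (k : ℕ) : rk (B ^ (k + 1 + 1)) < rk (B ^ (k + 1)) :=
    lt_of_le_of_ne (by rw [pow_succ' B (k + 1)]; exact rk_mul_le B _) (h (k + 1) k.succ_pos)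
  exact not_strictAnti_of_wellFoundedLT (fun k => rk (B ^ (k + 1))) (strictAnti_nat_of_succ_lt hlt)

theorem ind_spec (B : Matrix (Fin n) (Fin n) ℍ[ℝ]) :
    0 < ind B ∧ rk (B ^ (ind B + 1)) = rk (B ^ ind B) :=
  Nat.sInf_mem (exists_pos_rk_pow_succ_eq B)

theorem exists_mul_pow_succ_eq {B : Matrix (Fin n) (Fin n) ℍ[ℝ]} {l : ℕ}
    (hl : rk (B ^ (l + 1)) = rk (B ^ l)) : ∃ Z, Z * B ^ (l + 1) = B ^ l := by
  rw [pow_succ'] at hl ⊢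
  exact rk_mul_eq_iff.mp hl

theorem exists_pow_succ_mul_eq {B : Matrix (Fin n) (Fin n) ℍ[ℝ]} {l : ℕ}
    (hl : rk (B ^ (l + 1)) = rk (B ^ l)) : ∃ Z, B ^ (l + 1) * Z = B ^ l := by
  obtain ⟨Z, hZ⟩ := exists_mul_pow_succ_eq (B := Bᴴ) (l := l) (by
    rwa [← Matrix.conjTranspose_pow, ← Matrix.conjTranspose_pow, rk_conjTranspose,
      rk_conjTranspose])
  refine ⟨Zᴴ, Matrix.conjTranspose_injective ?_⟩
  rw [Matrix.conjTranspose_mul, Matrix.conjTranspose_conjTranspose, Matrix.conjTranspose_pow,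
    Matrix.conjTranspose_pow, hZ]

theorem exists_isDrazin (B : Matrix (Fin n) (Fin n) ℍ[ℝ]) : ∃ Y, IsDrazin B (ind B) Y := by
  obtain ⟨Z, hZ⟩ := exists_mul_pow_succ_eq (ind_spec B).2
  obtain ⟨Z', hZ'⟩ := exists_pow_succ_mul_eq (ind_spec B).2
  exact exists_isDrazin_of_pow_eq hZ hZ'

variable {A : Matrix (Fin m) (Fin n) ℍ[ℝ]} {W : Matrix (Fin n) (Fin m) ℍ[ℝ]}
  {X : Matrix (Fin m) (Fin n) ℍ[ℝ]}

theorem IsWeightedDrazin.isDrazin_mul_right (h : IsWeightedDrazin A W X) :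
    IsDrazin (A * W) (ind (A * W)) (X * W) := by
  obtain ⟨hpow, hXAX, hcomm⟩ := h
  refine ⟨?_, ?_, ?_⟩
  · rw [commute_iff_eq, ← Matrix.mul_assoc, hcomm, Matrix.mul_assoc _ A]
  · rw [← Matrix.mul_assoc, ← Matrix.mul_assoc, ← Matrix.mul_assoc, hXAX]
  · rw [← Matrix.mul_assoc, hpow]

theorem pow_mul_comm_mul (A : Matrix (Fin m) (Fin n) ℍ[ℝ]) (W : Matrix (Fin n) (Fin m) ℍ[ℝ])
    (s : ℕ) : (W * A) ^ s * W = W * (A * W) ^ s := by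
  induction s with
  | zero => rw [pow_zero, pow_zero, Matrix.one_mul, Matrix.mul_one]
  | succ s ih =>
    rw [pow_succ', pow_succ', Matrix.mul_assoc, ih]
    simp only [Matrix.mul_assoc]

theorem IsWeightedDrazin.isDrazin_mul_left (h : IsWeightedDrazin A W X) :
    IsDrazin (W * A) (ind (A * W) + 1) (W * X) := by
  obtain ⟨hpow, hXAX, hcomm⟩ := h
  refine ⟨?_, ?_, ?_⟩
  · rw [commute_iff_eq, Matrix.mul_assoc, ← Matrix.mul_assoc A, hcomm]
    simp only [Matrix.mul_assoc]
  · nth_rw 3 [← hXAX]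
    simp only [Matrix.mul_assoc]
  · calc (W * A) ^ (ind (A * W) + 1 + 1) * (W * X)
        = W * ((A * W) ^ (ind (A * W) + 1) * (A * W * X)) := by
          rw [← Matrix.mul_assoc, pow_mul_comm_mul, pow_succ, Matrix.mul_assoc, Matrix.mul_assoc]
      _ = W * (A * W) ^ ind (A * W) * A := by
          rw [hcomm, ← Matrix.mul_assoc _ _ A, ← Matrix.mul_assoc _ X, hpow, Matrix.mul_assoc]
      _ = (W * A) ^ (ind (A * W) + 1) := by
          rw [← pow_mul_comm_mul, Matrix.mul_assoc, pow_succ]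

theorem existsUnique_isWeightedDrazin (A : Matrix (Fin m) (Fin n) ℍ[ℝ])
    (W : Matrix (Fin n) (Fin m) ℍ[ℝ]) : ∃! X, IsWeightedDrazin A W X := by
  obtain ⟨Y, hY⟩ := exists_isDrazin (A * W)
  have hXW : Y * Y * A * W = Y := by
    rw [Matrix.mul_assoc _ A, Matrix.mul_assoc, ← hY.comm.eq, hY.mul_mul_self]
  have hBX : A * W * (Y * Y * A) = Y * A := by
    rw [← Matrix.mul_assoc, ← Matrix.mul_assoc, hY.comm.eq, Matrix.mul_assoc Y, hY.mul_mul_self]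
  refine ⟨Y * Y * A, ⟨?_, ?_, ?_⟩, fun X hX => ?_⟩
  · rw [Matrix.mul_assoc, hXW, hY.pow_succ_mul]
  · rw [hXW, Matrix.mul_assoc Y, Matrix.mul_assoc Y, hBX, ← Matrix.mul_assoc]
  · rw [hXW, hBX]
  · obtain rfl := hX.isDrazin_mul_right.eq hY
    rw [Matrix.mul_assoc (X * W), ← hX.2.2, ← Matrix.mul_assoc, ← Matrix.mul_assoc, hX.2.1]

theorem isWeightedDrazin_wDrazin (A : Matrix (Fin m) (Fin n) ℍ[ℝ])
    (W : Matrix (Fin n) (Fin m) ℍ[ℝ]) : IsWeightedDrazin A W (wDrazin A W) := by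
  have h := (existsUnique_isWeightedDrazin A W).exists
  rw [wDrazin, dif_pos h]
  exact h.choose_spec

end MatrixDrazinInverse

section HermitianDrazin

variable {n : ℕ} {H Y : Matrix (Fin n) (Fin n) ℍ[ℝ]} {l : ℕ}

theorem IsDrazin.mul_mul_eq_of_isHermitian (hY : IsDrazin H l Y) (hH : H.IsHermitian) :
    H * Y * H = H := by
  have hzero : H * (H * Y - 1) = 0 := mul_eq_zero_of_pow_mul hH l
    (by rw [mul_sub_one, ← mul_assoc, ← pow_succ, hY.pow_succ_mul, sub_self])
  rw [mul_sub_one, sub_eq_zero] at hzero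
  rw [mul_assoc, ← hY.comm.eq, hzero]

theorem IsDrazin.rk_pow (hY : IsDrazin H l Y) (hH : H.IsHermitian) {s : ℕ} (hs : s ≠ 0) :
    rk (H ^ s) = rk H := by
  obtain ⟨s, rfl⟩ := Nat.exists_eq_succ_of_ne_zero hs
  rw [Nat.succ_eq_add_one, pow_succ]
  refine rk_mul_eq_iff.mpr ⟨Y ^ (s + 1) * H, ?_⟩
  rw [← pow_succ, mul_assoc, ← pow_succ', pow_succ H, ← mul_assoc, ← (hY.comm.pow_pow _ _).eq,
    hY.pow_mul_pow, hY.mul_mul_eq_of_isHermitian hH]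

theorem IsDrazin.re_minorSum_pow_ne_zero (hY : IsDrazin H l Y) (hH : H.IsHermitian) {k s : ℕ}
    (hk : k ≠ 0) (hs : s ≠ 0) : (minorSum (H ^ s) (rk (H ^ k))).re ≠ 0 := by
  rw [hY.rk_pow hH hk, ← hY.rk_pow hH hs]
  exact re_minorSum_rk_ne_zero (hH.pow s)

theorem IsDrazin.pow_mul_cofSum_rk (hY : IsDrazin H l Y) (hH : H.IsHermitian) {k s : ℕ}
    (hk : k ≠ 0) (hs : s ≠ 0) :
    H ^ s * cofSum (H ^ s) (rk (H ^ k)) = (minorSum (H ^ s) (rk (H ^ k))).re • (H * Y) := by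
  rw [hY.rk_pow hH hk, ← hY.rk_pow hH hs]
  obtain ⟨s, rfl⟩ := Nat.exists_eq_succ_of_ne_zero hs
  refine mul_cofSum_rk_eq_smul (T := Y ^ (s + 1)) (hH.pow _) ?_ ?_
  · rw [pow_succ', ← mul_assoc, hY.mul_mul_eq_of_isHermitian hH]
  · rw [← (hY.comm.pow_pow _ _).eq, hY.pow_mul_pow]

end HermitianDrazin

section Representation

variable {m n : ℕ} {A : Matrix (Fin m) (Fin n) ℍ[ℝ]} {W : Matrix (Fin n) (Fin m) ℍ[ℝ]} {k : ℕ}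

theorem rdetSums_eq_smul_wcmp (hWA : (W * A).IsHermitian) (hk : k ≠ 0) :
    rdetSums (A * Aᴴ) (rk A) (rdetSums ((W * A) ^ (k + 2)) (rk ((W * A) ^ k))
      (cdetSums (Aᴴ * A) (rk A) (Aᴴ * A * W) * A * (W * A) ^ k) * W * A * Aᴴ) =
      ((minorSum (Aᴴ * A) (rk A)).re ^ 2 *
        (minorSum ((W * A) ^ (k + 2)) (rk ((W * A) ^ k))).re) • wcmp A W := by
  have hK := Matrix.isHermitian_conjTranspose_mul_self A
  have hY := (isWeightedDrazin_wDrazin A W).isDrazin_mul_left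
  have hHY := hY.pow_mul_cofSum_rk hWA hk (k + 1).succ_ne_zero
  set N := cofSum ((W * A) ^ (k + 2)) (rk ((W * A) ^ k))
  set d := (minorSum ((W * A) ^ (k + 2)) (rk ((W * A) ^ k))).re
  have hcomm : Commute (W * A) N :=
    commute_cofSum (hWA.pow (k + 2)) ((Commute.refl (W * A)).pow_right (k + 2)) _
  have hpow : W * A * (W * A) ^ k * (N * (W * A)) = (W * A) ^ (k + 2) * N := by
    rw [← hcomm.eq, ← pow_succ', ← mul_assoc, ← pow_succ]
  rw [cdetSums_eq_mul hK, rdetSums_eq_mul, rdetSums_eq_mul]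
  set c := (minorSum (Aᴴ * A) (rk A)).re
  calc cofSum (Aᴴ * A) (rk A) * (Aᴴ * A * W) * A * (W * A) ^ k * N * W * A * Aᴴ *
        cofSum (A * Aᴴ) (rk A)
      = cofSum (Aᴴ * A) (rk A) * (Aᴴ * A) * (W * A * (W * A) ^ k * N * W) *
        (A * Aᴴ * cofSum (A * Aᴴ) (rk A)) := by simp only [Matrix.mul_assoc]
    _ = c • (mpInv A * A) * (W * A * (W * A) ^ k * N * W) * (c • (A * mpInv A)) := by
        rw [← (commute_cofSum hK (Commute.refl _) _).eq, gram_mul_cofSum_rk, cogram_mul_cofSum_rk,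
          ← minorSum_gram]
    _ = c ^ 2 • (mpInv A * A * (W * A * (W * A) ^ k * (N * (W * A))) * mpInv A) := by
        simp only [Matrix.mul_smul, Matrix.smul_mul, smul_smul, sq, Matrix.mul_assoc]
    _ = c ^ 2 • (mpInv A * A * ((W * A) ^ (k + 2) * N) * mpInv A) := by
        rw [hpow]
    _ = (c ^ 2 * d) • wcmp A W := by
        rw [hHY, Matrix.mul_smul, Matrix.smul_mul, smul_smul, hY.comm.eq, wcmp]
        simp only [Matrix.mul_assoc]

theorem cdetSums_eq_smul_wcmp (hAW : (A * W).IsHermitian) (hk : k ≠ 0) :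
    cdetSums (Aᴴ * A) (rk A) (Aᴴ * A * W * cdetSums ((A * W) ^ (k + 2)) (rk ((A * W) ^ k))
      ((A * W) ^ k * A * rdetSums (A * Aᴴ) (rk A) (W * A * Aᴴ))) =
      ((minorSum (A * Aᴴ) (rk A)).re ^ 2 *
        (minorSum ((A * W) ^ (k + 2)) (rk ((A * W) ^ k))).re) • wcmp A W := by
  have hK := Matrix.isHermitian_conjTranspose_mul_self A
  have hY := (isWeightedDrazin_wDrazin A W).isDrazin_mul_right
  have hHY := hY.pow_mul_cofSum_rk hAW hk (k + 1).succ_ne_zero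
  set N := cofSum ((A * W) ^ (k + 2)) (rk ((A * W) ^ k))
  set d := (minorSum ((A * W) ^ (k + 2)) (rk ((A * W) ^ k))).re
  have hcomm : Commute (A * W) N :=
    commute_cofSum (hAW.pow (k + 2)) ((Commute.refl (A * W)).pow_right (k + 2)) _
  have hpow : A * W * N * ((A * W) ^ k * (A * W)) = (A * W) ^ (k + 2) * N := by
    rw [← pow_succ, mul_assoc, ← (hcomm.pow_left (k + 1)).eq, ← mul_assoc, ← pow_succ']
  rw [cdetSums_eq_mul hK, rdetSums_eq_mul, cdetSums_eq_mul (hAW.pow _)]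
  set c := (minorSum (A * Aᴴ) (rk A)).re
  calc cofSum (Aᴴ * A) (rk A) * (Aᴴ * A * W * (N * ((A * W) ^ k * A *
        (W * A * Aᴴ * cofSum (A * Aᴴ) (rk A)))))
      = cofSum (Aᴴ * A) (rk A) * (Aᴴ * A) * (W * N * ((A * W) ^ k * (A * W))) *
        (A * Aᴴ * cofSum (A * Aᴴ) (rk A)) := by simp only [Matrix.mul_assoc]
    _ = c • (mpInv A * A) * (W * N * ((A * W) ^ k * (A * W))) * (c • (A * mpInv A)) := by
        rw [← (commute_cofSum hK (Commute.refl _) _).eq, gram_mul_cofSum_rk, cogram_mul_cofSum_rk,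
          minorSum_gram]
    _ = c ^ 2 • (mpInv A * (A * W * N * ((A * W) ^ k * (A * W))) * (A * mpInv A)) := by
        simp only [Matrix.mul_smul, Matrix.smul_mul, smul_smul, sq, Matrix.mul_assoc]
    _ = c ^ 2 • (mpInv A * ((A * W) ^ (k + 2) * N) * (A * mpInv A)) := by
        rw [hpow]
    _ = (c ^ 2 * d) • wcmp A W := by
        rw [hHY, Matrix.mul_smul, Matrix.smul_mul, smul_smul, wcmp]
        simp only [Matrix.mul_assoc]

theorem apply_eq_div_of_eq_smul {X Y : Matrix (Fin n) (Fin m) ℍ[ℝ]} {t : ℝ} (ht : t ≠ 0)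
    (h : Y = t • X) (i : Fin n) (j : Fin m) : X i j = Y i j / (t : ℍ[ℝ]) := by
  rw [h, Matrix.smul_apply, ← Quaternion.mul_coe_eq_smul,
    mul_div_cancel_right₀ _ (Quaternion.coe_injective.ne ht)]

theorem ne_zero_and_apply_eq_div {X Y : Matrix (Fin n) (Fin m) ℍ[ℝ]} {c d : ℍ[ℝ]}
    (hcc : c = (c.re : ℍ[ℝ])) (hdd : d = (d.re : ℍ[ℝ])) (hc : c.re ≠ 0) (hd : d.re ≠ 0)
    (h : Y = (c.re ^ 2 * d.re) • X) :
    c ≠ 0 ∧ d ≠ 0 ∧ ∀ i j, X i j = Y i j / (c ^ 2 * d) := by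
  refine ⟨fun h0 => hc (congrArg (·.re) h0), fun h0 => hd (congrArg (·.re) h0), fun i j => ?_⟩
  rw [hcc, hdd, ← Quaternion.coe_pow, ← Quaternion.coe_mul]
  exact apply_eq_div_of_eq_smul (mul_ne_zero (pow_ne_zero 2 hc) hd) h i j

end Representation

end QuatMat

theorem theorem5p4_general {m n : ℕ} (A : Matrix (Fin m) (Fin n) (Quaternion ℝ))
    (W : Matrix (Fin n) (Fin m) (Quaternion ℝ))
    (r : ℕ) (hr : rk A = r) (k : ℕ) (hk : k ≠ 0) :
    (∃! X, IsMoorePenrose A X) ∧ (∃! X, IsWeightedDrazin A W X) ∧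
    (∀ r₁ : ℕ, (W * A).IsHermitian → rk ((W * A) ^ k) = r₁ →
      let Φ := cdetSums (Aᴴ * A) r (Aᴴ * A * W)
      let Φ₁ := Φ * A * (W * A) ^ k
      let Ω := rdetSums ((W * A) ^ (k + 2)) r₁ Φ₁
      let Ωt := Ω * W * A * Aᴴ
      minorSum (Aᴴ * A) r ≠ 0 ∧ minorSum ((W * A) ^ (k + 2)) r₁ ≠ 0 ∧
      ∀ (i : Fin n) (j : Fin m), wcmp A W i j =
        rdetSums (A * Aᴴ) r Ωt i j /
          (minorSum (Aᴴ * A) r ^ 2 * minorSum ((W * A) ^ (k + 2)) r₁)) ∧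
    (∀ r₁ : ℕ, (A * W).IsHermitian → rk ((A * W) ^ k) = r₁ →
      let Ψ := rdetSums (A * Aᴴ) r (W * A * Aᴴ)
      let Ψ₁ := (A * W) ^ k * A * Ψ
      let Υ := cdetSums ((A * W) ^ (k + 2)) r₁ Ψ₁
      let Υt := Aᴴ * A * W * Υ
      minorSum (A * Aᴴ) r ≠ 0 ∧ minorSum ((A * W) ^ (k + 2)) r₁ ≠ 0 ∧
      ∀ (i : Fin n) (j : Fin m), wcmp A W i j =
        cdetSums (Aᴴ * A) r Υt i j /
          (minorSum (A * Aᴴ) r ^ 2 * minorSum ((A * W) ^ (k + 2)) r₁)) := by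
  have hK := Matrix.isHermitian_conjTranspose_mul_self A
  have hK' := Matrix.isHermitian_mul_conjTranspose_self A
  have hX := isWeightedDrazin_wDrazin A W
  have hc := re_minorSum_gram_ne_zero A
  subst hr
  refine ⟨⟨mpInv A, isMoorePenrose_mpInv A, fun _ hX => hX.eq (isMoorePenrose_mpInv A)⟩,
    existsUnique_isWeightedDrazin A W, ?_, ?_⟩
  · rintro _ hWA rfl
    exact ne_zero_and_apply_eq_div (minorSum_eq_coe hK _) (minorSum_eq_coe (hWA.pow _) _) hc
      (hX.isDrazin_mul_left.re_minorSum_pow_ne_zero hWA hk (k + 1).succ_ne_zero)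
      (rdetSums_eq_smul_wcmp hWA hk)
  · rintro _ hAW rfl
    exact ne_zero_and_apply_eq_div (minorSum_eq_coe hK' _) (minorSum_eq_coe (hAW.pow _) _)
      (minorSum_gram A _ ▸ hc)
      (hX.isDrazin_mul_right.re_minorSum_pow_ne_zero hAW hk (k + 1).succ_ne_zero)
      (cdetSums_eq_smul_wcmp hAW hk)

theorem theorem5p4 {m n : ℕ} (A : Matrix (Fin m) (Fin n) (Quaternion ℝ))
    (W : Matrix (Fin n) (Fin m) (Quaternion ℝ)) (hW : W ≠ 0)
    (r : ℕ) (hr : rk A = r) (k : ℕ) (hk : k = max (ind (W * A)) (ind (A * W))) :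
    (∃! X, IsMoorePenrose A X) ∧ (∃! X, IsWeightedDrazin A W X) ∧
    (∀ r₁ : ℕ, (W * A).IsHermitian → rk ((W * A) ^ k) = r₁ →
      let Φ := cdetSums (Aᴴ * A) r (Aᴴ * A * W)
      let Φ₁ := Φ * A * (W * A) ^ k
      let Ω := rdetSums ((W * A) ^ (k + 2)) r₁ Φ₁
      let Ωt := Ω * W * A * Aᴴ
      minorSum (Aᴴ * A) r ≠ 0 ∧ minorSum ((W * A) ^ (k + 2)) r₁ ≠ 0 ∧
      ∀ (i : Fin n) (j : Fin m), wcmp A W i j =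
        rdetSums (A * Aᴴ) r Ωt i j /
          (minorSum (Aᴴ * A) r ^ 2 * minorSum ((W * A) ^ (k + 2)) r₁)) ∧
    (∀ r₁ : ℕ, (A * W).IsHermitian → rk ((A * W) ^ k) = r₁ →
      let Ψ := rdetSums (A * Aᴴ) r (W * A * Aᴴ)
      let Ψ₁ := (A * W) ^ k * A * Ψ
      let Υ := cdetSums ((A * W) ^ (k + 2)) r₁ Ψ₁
      let Υt := Aᴴ * A * W * Υ
      minorSum (A * Aᴴ) r ≠ 0 ∧ minorSum ((A * W) ^ (k + 2)) r₁ ≠ 0 ∧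
      ∀ (i : Fin n) (j : Fin m), wcmp A W i j =
        cdetSums (Aᴴ * A) r Υt i j /
          (minorSum (A * Aᴴ) r ^ 2 * minorSum ((A * W) ^ (k + 2)) r₁)) :=
  theorem5p4_general A W r hr k
    (hk ▸ ((ind_spec (A * W)).1.trans_le (le_max_right _ _)).ne')
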